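/- **Theorem 1.4 (standing wave solutions).** Let $d\ge 1$, $N\ge 2$, let $\mathbf n=(n_1,\dots,n_N)$ be a vector of positive integers, and let $2^*=\infty$ for $d=1,2$ and $2^*=\frac{2d}{d-2}$ for $d\ge3$. Let $p\in(2,2^*)$ and let $g:\mathbb C^N\to\mathbb R$ be twice continuously differentiable (as a function on $\mathbb R^{2N}$), homogeneous of degree $p$, i.e. $g(rz)=r^p g(z)$ for all $z\in\mathbb C^N$ and $r\ge 0$, and gauge invariant in the sense that $$g(e^{in_1\theta}z_1,\dots,e^{in_N\theta}z_N)=g(z_1,\dots,z_N)\qquad (z\in\mathbb C^N,\ \theta\in\mathbb R).$$ Put $F_j=\frac2p\,\partial_{\overline{z_j}}g$, where $\partial_{\overline{z}}=\frac12(\partial_x+i\partial_y)$ for $z=x+iy$. Let $\omega>0$ and let $\mathcal A_\omega$ be the set of nontrivial solutions in $(H^1(\mathbb R^d))^N$ of the elliptic system $$-\Delta u_j+\omega u_j=-F_j(u_1,\dots,u_N)\qquad(j=1,\dots,N),$$ that is, the set of $\Phi\in (H^1(\mathbb R^d))^N$, $\Phi\ne0$, with $S_\omega'(\Phi)=0$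 for the action $$S_\omega(\mathbf u)=\sum_{j=1}^N\int_{\mathbb R^d}\tfrac12|\nabla u_j|^2\,dx+\int_{\mathbb R^d}\tfrac1p\,g(\mathbf u)\,dx+\omega\sum_{j=1}^N\int_{\mathbb R^d}\tfrac12|u_j|^2\,dx .$$ If $\Phi=(\phi_1,\dots,\phi_N)\in\mathcal A_\omega$, then $$\mathbf u(t)=(e^{in_1\omega t}\phi_1,\dots,e^{in_N\omega t}\phi_N)$$ is a global $H^1$-solution of $$(i\partial_t+n_j\Delta)u_j=n_jF_j(u_1,\dots,u_N),\qquad u_j(0)=\phi_j\qquad(j=1,\dots,N).$$ This means that $$\mathbf u\in \bigl(C(\mathbb R,H^1(\mathbb R^d))\cap L^{q_d}_{\mathrm{loc}}(\mathbb R,W^{1,r_d}(\mathbb R^d))\bigr)^N,$$ where $(q_1,r_1)=(4,\infty)$, $(q_2,r_2)=(\frac{2p}{p-2},p)$ and $(q_d,r_d)=(2,2^*)$ for $d\ge3$, and that for all $t\in\mathbb R$ and $j=1,\dots,N$ $$u_j(t)=e^{itn_j\Delta}\phi_j-i\int_0^t e^{i(t-s)n_j\Delta}\,n_jF_j(\mathbf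 u(s))\,ds ,$$ as an identity in $L^2(\mathbb R^d)$: $F_j(\mathbf u(s))\in L^2(\mathbb R^d)$ for almost every $s\in\mathbb R$, and the integral is a Bochner integral in $L^2(\mathbb R^d)$. -/

import Mathlib

open MeasureTheory
open scoped ENNReal FourierTransform

noncomputable section

/-! ### Sobolev spaces `W^{1,r}(ℝ^d)` -/

/-- `ℝ^d` with its Euclidean norm. -/
abbrev RSpace (d : ℕ) : Type := EuclideanSpace ℝ (Fin d)

/-- The complex Lebesgue space `L^r(ℝ^d)`. -/
abbrev LSpace (d : ℕ) (r : ℝ≥0∞) : Type := Lp (α := RSpace d) ℂ r volume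

/-- `h` is the weak partial derivative `∂_k f` on `ℝ^d`. -/
def IsWeakPartial {d : ℕ} (k : Fin d) (f h : RSpace d → ℂ) : Prop :=
  ∀ η : RSpace d → ℝ, ContDiff ℝ (⊤ : ℕ∞) η → HasCompactSupport η →
    ∫ x, fderiv ℝ η x (EuclideanSpace.single k 1) • f x = - ∫ x, η x • h x

theorem integrable_test_smul {d : ℕ} {r : ℝ≥0∞} [hr : Fact (1 ≤ r)] (f : LSpace d r)
    {η : RSpace d → ℝ} (hc : Continuous η) (hs : HasCompactSupport η) :
    Integrable (fun x => η x • f x) :=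
  ((Lp.memLp f).locallyIntegrable hr.out).integrable_smul_left_of_hasCompactSupport hc hs

theorem integrable_fderiv_test_smul {d : ℕ} {r : ℝ≥0∞} [Fact (1 ≤ r)] (f : LSpace d r)
    {η : RSpace d → ℝ} (hc : ContDiff ℝ (⊤ : ℕ∞) η) (hs : HasCompactSupport η) (v : RSpace d) :
    Integrable (fun x => fderiv ℝ η x v • f x) :=
  integrable_test_smul f ((hc.continuous_fderiv (by simp)).clm_apply continuous_const)
    (hs.fderiv_apply (𝕜 := ℝ) v)

/-- The Sobolev space `W^{1,r}(ℝ^d)`: pairs of a function in `L^r` and its weak gradient in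
`(L^r)^d`, with the norm `max (‖f‖_r, ‖∂_1 f‖_r, …, ‖∂_d f‖_r)`, which is equivalent to the
usual one. The gradient is determined by the function. -/
def W1 (d : ℕ) (r : ℝ≥0∞) [Fact (1 ≤ r)] : Submodule ℂ (LSpace d r × (Fin d → LSpace d r)) where
  carrier := {f | ∀ k, IsWeakPartial k f.1 (f.2 k)}
  zero_mem' := by
    intro k η _ _
    have h : ∀ ζ : RSpace d → ℝ,
        ∫ x, ζ x • (0 : LSpace d r) x = 0 := by
      intro ζ
      simp
    change ∫ x, _ • (0 : LSpace d r) x = - ∫ x, _ • (0 : LSpace d r) x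
    rw [h, h, neg_zero]
  add_mem' := by
    intro f g hf hg k η hη hs
    have h : ∀ (ζ : RSpace d → ℝ) (a b : LSpace d r), Integrable (fun x => ζ x • a x) →
        Integrable (fun x => ζ x • b x) →
        ∫ x, ζ x • (a + b) x = (∫ x, ζ x • a x) + ∫ x, ζ x • b x := by
      intro ζ a b ha hb
      rw [← integral_add ha hb]
      refine integral_congr_ae ?_
      filter_upwards [Lp.coeFn_add a b] with x hx
      rw [hx, Pi.add_apply, smul_add]
    change ∫ x, _ • (f.1 + g.1) x = - ∫ x, _ • (f.2 k + g.2 k) x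
    rw [h _ _ _ (integrable_fderiv_test_smul _ hη hs _) (integrable_fderiv_test_smul _ hη hs _),
      h _ _ _ (integrable_test_smul _ hη.continuous hs) (integrable_test_smul _ hη.continuous hs),
      hf k η hη hs, hg k η hη hs, neg_add]
  smul_mem' := by
    intro c f hf k η hη hs
    have h : ∀ (ζ : RSpace d → ℝ) (a : LSpace d r),
        ∫ x, ζ x • (c • a) x = c • ∫ x, ζ x • a x := by
      intro ζ a
      rw [← integral_smul]
      refine integral_congr_ae ?_
      filter_upwards [Lp.coeFn_smul c a] with x hx
      rw [hx, Pi.smul_apply, smul_comm]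
    change ∫ x, _ • (c • f.1) x = - ∫ x, _ • (c • f.2 k) x
    rw [h, h, hf k η hη hs, smul_neg]

/-- The underlying function of an element of `W^{1,r}`. -/
def W1.fn {d : ℕ} {r : ℝ≥0∞} [Fact (1 ≤ r)] (f : W1 d r) : LSpace d r := f.1.1

/-- The weak partial derivative `∂_k f` of an element of `W^{1,r}`. -/
def W1.grad {d : ℕ} {r : ℝ≥0∞} [Fact (1 ≤ r)] (f : W1 d r) (k : Fin d) : LSpace d r := f.1.2 k

/-- `H^1(ℝ^d) = W^{1,2}(ℝ^d)`. -/
abbrev H1 (d : ℕ) : Type := W1 d 2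

/-! ### Exponents -/

/-- The critical exponent `2^*`: `∞` for `d ≤ 2` and `2d/(d-2)` for `d ≥ 3`. -/
def critExp (d : ℕ) : ℝ≥0∞ :=
  if d ≤ 2 then ⊤ else ENNReal.ofReal (2 * d / (d - 2))

/-- The time exponent `q_d`. -/
def timeExp (d : ℕ) (p : ℝ) : ℝ≥0∞ :=
  if d = 1 then 4 else if d = 2 then ENNReal.ofReal (2 * p / (p - 2)) else 2

/-- The space exponent `r_d`. -/
def spaceExp (d : ℕ) (p : ℝ) : ℝ≥0∞ :=
  if d = 1 then ⊤ else if d = 2 then ENNReal.ofReal p else critExp d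

theorem one_le_spaceExp (d : ℕ) {p : ℝ} (hp : 2 < p) : 1 ≤ spaceExp d p := by
  unfold spaceExp critExp
  split_ifs with h1 h2 h3
  · simp
  · rw [ENNReal.one_le_ofReal]; linarith
  · simp
  · rw [ENNReal.one_le_ofReal]
    have h : (3 : ℝ) ≤ d := by exact_mod_cast (by omega : 3 ≤ d)
    rw [le_div_iff₀ (by linarith)]
    linarith

/-! ### The nonlinearity -/

/-- The Wirtinger derivative `∂g/∂\bar z_j = (1/2) (∂_{x_j} + i ∂_{y_j}) g` of `g : ℂ^N → ℝ`. -/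
def wirtingerBar {N : ℕ} (g : (Fin N → ℂ) → ℝ) (j : Fin N) (z : Fin N → ℂ) : ℂ :=
  (1 / 2 : ℂ) * ((fderiv ℝ g z (Pi.single j 1) : ℂ) +
    Complex.I * (fderiv ℝ g z (Pi.single j Complex.I) : ℂ))

/-- The nonlinearity `F_j = (2/p) ∂g/∂\bar z_j`. -/
def nonlin {N : ℕ} (g : (Fin N → ℂ) → ℝ) (p : ℝ) (j : Fin N) (z : Fin N → ℂ) : ℂ :=
  ((2 / p : ℝ) : ℂ) * wirtingerBar g j z

/-- `g` is of class `C^2` (in the real sense) and positively homogeneous of degree `p`, where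
`2 < p < 2^*`. -/
structure HomogeneousPotential (d N : ℕ) (g : (Fin N → ℂ) → ℝ) (p : ℝ) : Prop where
  two_lt : 2 < p
  lt_critExp : ENNReal.ofReal p < critExp d
  contDiff : ContDiff ℝ 2 g
  homogeneous : ∀ (z : Fin N → ℂ) (r : ℝ), 0 ≤ r → g (fun j => (r : ℂ) * z j) = r ^ p * g z

/-- The gauge condition `g(e^{i n_1 θ} z_1, …, e^{i n_N θ} z_N) = g(z_1, …, z_N)`. -/
def GaugeInvariant {N : ℕ} (n : Fin N → ℕ) (g : (Fin N → ℂ) → ℝ) : Prop :=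
  ∀ (z : Fin N → ℂ) (θ : ℝ), g (fun j => Complex.exp (Complex.I * (n j * θ : ℝ)) * z j) = g z

/-! ### The elliptic system -/

/-- The energy `E(u) = ∑_j ∫ |∇u_j|²/2 + ∫ g(u)/p`. -/
def energy {d N : ℕ} (g : (Fin N → ℂ) → ℝ) (p : ℝ) (u : Fin N → H1 d) : ℝ :=
  (∑ j, ∫ x, (1 / 2 : ℝ) * ∑ k, ‖W1.grad (u j) k x‖ ^ 2) +
    ∫ x, (1 / p) * g (fun j => W1.fn (u j) x)

/-- The mass `M(u) = ∑_j ∫ |u_j|²/2`. -/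
def mass {d N : ℕ} (u : Fin N → H1 d) : ℝ :=
  ∑ j, ∫ x, (1 / 2 : ℝ) * ‖W1.fn (u j) x‖ ^ 2

/-- The action `S_ω = E + ω M`. -/
def action {d N : ℕ} (g : (Fin N → ℂ) → ℝ) (p ω : ℝ) (u : Fin N → H1 d) : ℝ :=
  energy g p u + ω * mass u

/-- The set `𝒜_ω` of (nontrivial) solutions of the elliptic system
`-Δu_j + ω u_j = -F_j(u)`, `1 ≤ j ≤ N`: the nonzero critical points of `S_ω` on
`(H^1(ℝ^d))^N`, regarded as a real Banach space. -/
def ellipticSolutions (d : ℕ) {N : ℕ} (g : (Fin N → ℂ) → ℝ) (p ω : ℝ) : Set (Fin N → H1 d) :=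
  {Φ | Φ ≠ 0 ∧ HasFDerivAt (𝕜 := ℝ) (action g p ω) 0 Φ}

/-! ### The Schrödinger system -/

/-- The Fourier symbol `exp(-4π² i t |ξ|²)` of `e^{itΔ}`, for the Fourier transform
`∫ e^{-2π i x·ξ} f(x) dx`. -/
def schrodingerSymbol {d : ℕ} (t : ℝ) (ξ : RSpace d) : ℂ :=
  Complex.exp (-Complex.I * (4 * Real.pi ^ 2 * t * ‖ξ‖ ^ 2 : ℝ))

theorem norm_schrodingerSymbol {d : ℕ} (t : ℝ) (ξ : RSpace d) :
    ‖schrodingerSymbol t ξ‖ = 1 := by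
  rw [schrodingerSymbol, neg_mul, ← mul_neg, ← Complex.ofReal_neg, mul_comm]
  exact Complex.norm_exp_ofReal_mul_I _

theorem continuous_schrodingerSymbol {d : ℕ} (t : ℝ) :
    Continuous (schrodingerSymbol t : RSpace d → ℂ) := by
  unfold schrodingerSymbol
  fun_prop

theorem memLp_schrodingerSymbol_mul {d : ℕ} (t : ℝ) (f : LSpace d 2) :
    MemLp (fun ξ => schrodingerSymbol t ξ * f ξ) 2 volume :=
  (Lp.memLp f).of_le
    ((continuous_schrodingerSymbol t).aestronglyMeasurable.mul (Lp.aestronglyMeasurable f))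
    (Filter.Eventually.of_forall fun ξ => by rw [norm_mul, norm_schrodingerSymbol, one_mul])

/-- The free Schrödinger group `e^{itΔ}` on `L^2(ℝ^d)`. -/
def freeEvolution {d : ℕ} (t : ℝ) (f : LSpace d 2) : LSpace d 2 :=
  𝓕⁻ ((memLp_schrodingerSymbol_mul t (𝓕 f)).toLp _)

/-- `u ∈ L^q_loc(I, W^{1,r}(ℝ^d))`, for a curve `u` in `H^1(ℝ^d)`. -/
def MemLocLpW1 {d : ℕ} (I : Set ℝ) (q r : ℝ≥0∞) [Fact (1 ≤ r)] (u : ℝ → H1 d) : Prop :=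
  ∃ v : ℝ → W1 d r,
    (∀ᵐ t ∂volume.restrict I, W1.fn (v t) =ᵐ[volume] W1.fn (u t)) ∧
    ∀ K ⊆ I, IsCompact K → MemLp v q (volume.restrict K)

/-- The Duhamel formula on `I`,
`u_j(t) = e^{i t n_j Δ} u_{j,0} - i ∫_0^t e^{i (t-s) n_j Δ} n_j F_j(u(s)) ds`,
as an identity in `L^2(ℝ^d)` with a Bochner integral on the right; here `f j` is the curve
`s ↦ F_j(u(s))` in `L^2(ℝ^d)`, defined for almost every `s ∈ I`. -/
def DuhamelFormula {d N : ℕ} (n : Fin N → ℕ) (F : Fin N → (Fin N → ℂ) → ℂ)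
    (I : Set ℝ) (u₀ : Fin N → H1 d) (u : ℝ → Fin N → H1 d) : Prop :=
  ∃ f : Fin N → ℝ → LSpace d 2,
    (∀ j, ∀ᵐ s ∂volume.restrict I,
      f j s =ᵐ[volume] fun x => F j (fun k => W1.fn (u s k) x)) ∧
    ∀ j, ∀ t ∈ I,
      IntervalIntegrable (fun s => freeEvolution ((t - s) * n j) ((n j : ℂ) • f j s)) volume 0 t ∧
      W1.fn (u t j) = freeEvolution (t * n j) (W1.fn (u₀ j)) -
        Complex.I • ∫ s in (0 : ℝ)..t, freeEvolution ((t - s) * n j) ((n j : ℂ) • f j s)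

/-- `u` is an `H^1`-solution, on the interval `I` with `0 ∈ closure I`, of the system
`(i ∂_t + n_j Δ) u_j = n_j F_j(u)`, `u_j(0) = u_{j,0}`, where `F_j = (2/p) ∂g/∂\bar z_j`:
it belongs to `(C(I, H^1) ∩ L^{q_d}_loc(I, W^{1,r_d}))^N` and satisfies the Duhamel formula. -/
def IsH1Solution {d N : ℕ} (n : Fin N → ℕ) (g : (Fin N → ℂ) → ℝ) {p : ℝ} (hp : 2 < p)
    (I : Set ℝ) (u₀ : Fin N → H1 d) (u : ℝ → Fin N → H1 d) : Prop :=
  haveI : Fact (1 ≤ spaceExp d p) := ⟨one_le_spaceExp d hp⟩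
  I.OrdConnected ∧ 0 ∈ closure I ∧
  ContinuousOn u I ∧
  (∀ j, MemLocLpW1 I (timeExp d p) (spaceExp d p) (fun t => u t j)) ∧
  DuhamelFormula n (nonlin g p) I u₀ u

/-- A global `H^1`-solution: an `H^1`-solution on all of `ℝ`. -/
def IsGlobalH1Solution {d N : ℕ} (n : Fin N → ℕ) (g : (Fin N → ℂ) → ℝ) {p : ℝ} (hp : 2 < p)
    (u₀ : Fin N → H1 d) (u : ℝ → Fin N → H1 d) : Prop :=
  IsH1Solution n g hp Set.univ u₀ u

/-- The standing wave `(e^{i n_1 ω t} φ_1, …, e^{i n_N ω t} φ_N)`. -/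
def standingWave {d N : ℕ} (n : Fin N → ℕ) (ω : ℝ) (Φ : Fin N → H1 d) (t : ℝ) :
    Fin N → H1 d :=
  fun j => Complex.exp (Complex.I * (n j * ω * t : ℝ)) • Φ j

end

noncomputable section

open Filter Topology SchwartzMap LineDeriv

/-- Smooth cutoff functions exhausting the space, with uniformly bounded derivatives. -/
theorem exists_cutoff_sequence (d : ℕ) : ∃ (χ : ℕ → RSpace d → ℝ) (C : ℝ), 0 ≤ C ∧
    (∀ n, ContDiff ℝ (⊤ : ℕ∞) (χ n)) ∧ (∀ n, HasCompactSupport (χ n)) ∧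
    (∀ n x, |χ n x| ≤ 1) ∧ (∀ n x, ‖fderiv ℝ (χ n) x‖ ≤ C) ∧
    ∀ x, ∀ᶠ n in atTop, χ n =ᶠ[𝓝 x] fun _ => 1 := by
  let b : ContDiffBump (0 : RSpace d) := ⟨1, 2, one_pos, one_lt_two⟩
  have hb : ContDiff ℝ (⊤ : ℕ∞) b := b.contDiff
  obtain ⟨C, hC⟩ := (hb.continuous_fderiv (by simp)).bounded_above_of_compact_support
    (b.hasCompactSupport.fderiv (𝕜 := ℝ))
  have hpos : ∀ n : ℕ, (0 : ℝ) < ((n : ℝ) + 1)⁻¹ := fun n => by positivity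
  have hle : ∀ n : ℕ, ((n : ℝ) + 1)⁻¹ ≤ 1 := fun n =>
    inv_le_one_of_one_le₀ (by linarith [n.cast_nonneg (α := ℝ)])
  refine ⟨fun n x => b (((n : ℝ) + 1)⁻¹ • x), C, (norm_nonneg _).trans (hC 0), fun n => ?_,
    fun n => ?_, fun n x => ?_, fun n x => ?_, fun x => ?_⟩
  · exact hb.comp (contDiff_const_smul _)
  · exact b.hasCompactSupport.comp_smul (hpos n).ne'
  · rw [abs_of_nonneg b.nonneg]
    exact b.le_one
  · have h1 : fderiv ℝ (fun x => b (((n : ℝ) + 1)⁻¹ • x)) x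
        = ((n : ℝ) + 1)⁻¹ • fderiv ℝ b (((n : ℝ) + 1)⁻¹ • x) := fderiv_comp_smul _
    rw [h1, norm_smul, Real.norm_of_nonneg (hpos n).le]
    exact (mul_le_of_le_one_left (norm_nonneg _) (hle n)).trans (hC _)
  · obtain ⟨m, hm⟩ := exists_nat_gt ‖x‖
    filter_upwards [eventually_ge_atTop m] with n hn
    have hx : x ∈ Metric.ball (0 : RSpace d) ((n : ℝ) + 1) := by
      rw [mem_ball_zero_iff]
      have : (m : ℝ) ≤ n := by exact_mod_cast hn
      linarith
    filter_upwards [Metric.isOpen_ball.mem_nhds hx] with y hy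
    apply b.one_of_mem_closedBall
    rw [mem_ball_zero_iff] at hy
    rw [mem_closedBall_zero_iff, norm_smul, Real.norm_of_nonneg (hpos n).le]
    change _ ≤ (1 : ℝ)
    rw [inv_mul_le_iff₀ (by positivity)]
    linarith

theorem integrable_mul_of_L2 {d : ℕ} {f g : RSpace d → ℂ} (hf : MemLp f 2) (hg : MemLp g 2) :
    Integrable (fun x => f x • g x) := hf.integrable_mul hg

theorem integral_smul_re_im {d : ℕ} {η f : RSpace d → ℂ}
    (h1 : Integrable (fun x => (η x).re • f x)) (h2 : Integrable (fun x => (η x).im • f x)) :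
    ∫ x, η x • f x = (∫ x, (η x).re • f x) + Complex.I * ∫ x, (η x).im • f x := by
  rw [← integral_const_mul, ← integral_add h1 (h2.const_mul _)]
  congr 1 with x
  simp only [smul_eq_mul, Complex.real_smul]
  conv_lhs => rw [← Complex.re_add_im (η x)]
  ring

/-- Weak derivatives may be tested against complex test functions. -/
theorem IsWeakPartial.complex_test {d : ℕ} {k : Fin d} {f h : RSpace d → ℂ}
    (hf : LocallyIntegrable f) (hh : LocallyIntegrable h)
    (hw : IsWeakPartial k f h) {η : RSpace d → ℂ} (hη : ContDiff ℝ (⊤ : ℕ∞) η)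
    (hs : HasCompactSupport η) :
    ∫ x, fderiv ℝ η x (EuclideanSpace.single k 1) • f x = - ∫ x, η x • h x := by
  have hre : ContDiff ℝ (⊤ : ℕ∞) (fun x => (η x).re) := Complex.reCLM.contDiff.comp hη
  have him : ContDiff ℝ (⊤ : ℕ∞) (fun x => (η x).im) := Complex.imCLM.contDiff.comp hη
  have hsre : HasCompactSupport (fun x => (η x).re) := hs.comp_left (g := Complex.re) rfl
  have hsim : HasCompactSupport (fun x => (η x).im) := hs.comp_left (g := Complex.im) rfl
  have hd : Differentiable ℝ η := hη.differentiable (by simp)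
  have hdre : ∀ x v, (fderiv ℝ η x v).re = fderiv ℝ (fun x => (η x).re) x v := fun x v => by
    have : HasFDerivAt (fun x => (η x).re) (Complex.reCLM.comp (fderiv ℝ η x)) x :=
      Complex.reCLM.hasFDerivAt.comp x (hd x).hasFDerivAt
    rw [this.fderiv]; rfl
  have hdim : ∀ x v, (fderiv ℝ η x v).im = fderiv ℝ (fun x => (η x).im) x v := fun x v => by
    have : HasFDerivAt (fun x => (η x).im) (Complex.imCLM.comp (fderiv ℝ η x)) x :=
      Complex.imCLM.hasFDerivAt.comp x (hd x).hasFDerivAt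
    rw [this.fderiv]; rfl
  have key : ∀ ζ : RSpace d → ℝ, ContDiff ℝ (⊤ : ℕ∞) ζ → HasCompactSupport ζ →
      Integrable (fun x => fderiv ℝ ζ x (EuclideanSpace.single k 1) • f x) := fun ζ h1 h2 =>
    hf.integrable_smul_left_of_hasCompactSupport
      ((h1.continuous_fderiv (by simp)).clm_apply continuous_const) (h2.fderiv_apply (𝕜 := ℝ) _)
  rw [integral_smul_re_im, integral_smul_re_im]
  · simp only [hdre, hdim]
    rw [hw _ hre hsre, hw _ him hsim]
    ring
  · exact hh.integrable_smul_left_of_hasCompactSupport hre.continuous hsre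
  · exact hh.integrable_smul_left_of_hasCompactSupport him.continuous hsim
  · simpa only [hdre] using key _ hre hsre
  · simpa only [hdim] using key _ him hsim

/-- Weak derivatives of `L²` functions may be tested against Schwartz functions. -/
theorem IsWeakPartial.schwartz_test {d : ℕ} {k : Fin d} {f h : RSpace d → ℂ}
    (hf : MemLp f 2) (hh : MemLp h 2) (hw : IsWeakPartial k f h) (ψ : 𝓢(RSpace d, ℂ)) :
    ∫ x, fderiv ℝ ψ x (EuclideanSpace.single k 1) • f x = - ∫ x, ψ x • h x := by
  obtain ⟨χ, C, hC, hsm, hcs, hle, hder, hev⟩ := exists_cutoff_sequence d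
  set e : RSpace d := EuclideanSpace.single k 1
  have he : ‖e‖ = 1 := by simp [e]
  have hψ : MemLp ψ 2 := ψ.memLp 2
  have hdψ : MemLp (fun x => fderiv ℝ ψ x e) 2 volume := (∂_{e} ψ).memLp 2 volume
  have hd : ∀ n x, fderiv ℝ (fun x => (χ n x : ℂ) * ψ x) x e
      = (χ n x : ℂ) * fderiv ℝ ψ x e + (fderiv ℝ (χ n) x e : ℂ) * ψ x := by
    intro n x
    have h1 : HasFDerivAt (fun x => (χ n x : ℂ)) (Complex.ofRealCLM.comp (fderiv ℝ (χ n) x)) x :=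
      Complex.ofRealCLM.hasFDerivAt.comp x ((hsm n).differentiable (by simp) x).hasFDerivAt
    rw [(h1.fun_mul (ψ.differentiableAt.hasFDerivAt)).fderiv]
    simp [mul_comm]
  have heq : ∀ n, ∫ x, fderiv ℝ (fun x => (χ n x : ℂ) * ψ x) x e • f x
      = - ∫ x, ((χ n x : ℂ) * ψ x) • h x := fun n =>
    hw.complex_test (hf.locallyIntegrable (by norm_num)) (hh.locallyIntegrable (by norm_num))
      ((Complex.ofRealCLM.contDiff.comp (hsm n)).mul (ψ.smooth _))
      (((hcs n).comp_left (g := Complex.ofReal) rfl).mul_right)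
  have hχm : ∀ n, AEStronglyMeasurable (fun x => (χ n x : ℂ)) volume := fun n =>
    (Complex.continuous_ofReal.comp (hsm n).continuous).aestronglyMeasurable
  have hχd : ∀ n, AEStronglyMeasurable (fun x => (fderiv ℝ (χ n) x e : ℂ)) volume := fun n =>
    (Complex.continuous_ofReal.comp
      (((hsm n).continuous_fderiv (by simp)).clm_apply continuous_const)).aestronglyMeasurable
  have hnχ : ∀ n x, ‖(χ n x : ℂ)‖ ≤ 1 := fun n x => by simpa using hle n x
  have hnd : ∀ n x, ‖(fderiv ℝ (χ n) x e : ℂ)‖ ≤ C := fun n x => by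
    rw [Complex.norm_real]
    simpa [he] using (fderiv ℝ (χ n) x).le_of_opNorm_le (hder n x) e
  have lim1 : Tendsto (fun n => ∫ x, fderiv ℝ (fun x => (χ n x : ℂ) * ψ x) x e • f x) atTop
      (𝓝 (∫ x, fderiv ℝ ψ x e • f x)) := by
    simp only [hd]
    refine tendsto_integral_of_dominated_convergence
      (fun x => ‖fderiv ℝ ψ x e • f x‖ + C * ‖ψ x • f x‖) (fun n => ?_) ?_ (fun n => ?_) ?_
    · exact (((hχm n).mul hdψ.1).add ((hχd n).mul hψ.1)).smul hf.1
    · exact (integrable_mul_of_L2 hdψ hf).norm.add ((integrable_mul_of_L2 hψ hf).norm.const_mul _)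
    · refine Eventually.of_forall fun x => ?_
      rw [add_smul]
      refine (norm_add_le _ _).trans (add_le_add ?_ ?_)
      · rw [mul_smul, norm_smul]
        exact mul_le_of_le_one_left (norm_nonneg _) (hnχ n x)
      · rw [mul_smul, norm_smul]
        gcongr
        exact hnd n x
    · refine Eventually.of_forall fun x => tendsto_const_nhds.congr' ?_
      filter_upwards [hev x] with n hn
      have h2 : fderiv ℝ (χ n) x = 0 := by rw [hn.fderiv_eq]; simp
      rw [h2, hn.eq_of_nhds]
      simp
  have lim2 : Tendsto (fun n => ∫ x, ((χ n x : ℂ) * ψ x) • h x) atTop (𝓝 (∫ x, ψ x • h x)) := by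
    refine tendsto_integral_of_dominated_convergence
      (fun x => ‖ψ x • h x‖) (fun n => ?_) ?_ (fun n => ?_) ?_
    · exact ((hχm n).mul hψ.1).smul hh.1
    · exact (integrable_mul_of_L2 hψ hh).norm
    · refine Eventually.of_forall fun x => ?_
      rw [mul_smul, norm_smul]
      exact mul_le_of_le_one_left (norm_nonneg _) (hnχ n x)
    · refine Eventually.of_forall fun x => tendsto_const_nhds.congr' ?_
      filter_upwards [hev x] with n hn
      rw [hn.eq_of_nhds]
      simp
  exact tendsto_nhds_unique (lim1.congr heq) lim2.neg

/-- The Fourier symbol `2πi ξ_k` of `∂_k`. -/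
def partialSymbol {d : ℕ} (k : Fin d) (ξ : RSpace d) : ℂ := 2 * Real.pi * Complex.I * (ξ k : ℂ)

theorem continuous_partialSymbol {d : ℕ} (k : Fin d) : Continuous (partialSymbol k) := by
  unfold partialSymbol
  fun_prop

theorem inner_single_eq {d : ℕ} (k : Fin d) (ξ : RSpace d) :
    inner ℝ ξ (EuclideanSpace.single k (1 : ℝ)) = ξ k := by
  simp [EuclideanSpace.inner_single_right]

theorem isWeakPartial_iff_lineDeriv {d : ℕ} (k : Fin d) (f h : LSpace d 2) :
    IsWeakPartial k f h ↔
      ∂_{(EuclideanSpace.single k 1 : RSpace d)} (f : 𝓢'(RSpace d, ℂ)) = (h : 𝓢'(RSpace d, ℂ)) := by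
  constructor
  · intro hw
    ext ψ
    rw [TemperedDistribution.lineDerivOp_apply_apply, Lp.toTemperedDistribution_apply,
      Lp.toTemperedDistribution_apply]
    have := hw.schwartz_test (Lp.memLp f) (Lp.memLp h) ψ
    rw [← neg_eq_iff_eq_neg, ← integral_neg] at this
    rw [← this]
    congr 1 with x
    rw [← neg_smul]
    rfl
  · intro hd η hη hs
    have hs' : HasCompactSupport (Complex.ofRealCLM ∘ η) := hs.comp_left rfl
    have hη' : ContDiff ℝ (⊤ : ℕ∞) (Complex.ofRealCLM ∘ η) := by fun_prop
    have := DFunLike.congr_fun hd (hs'.toSchwartzMap hη')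
    rw [TemperedDistribution.lineDerivOp_apply_apply, Lp.toTemperedDistribution_apply,
      Lp.toTemperedDistribution_apply] at this
    rw [← neg_eq_iff_eq_neg, ← integral_neg]
    calc _ = _ := ?_
      _ = _ := this
      _ = _ := ?_
    · congr 1 with x
      rw [← neg_smul]
      have h1 : HasFDerivAt (Complex.ofRealCLM ∘ η) (Complex.ofRealCLM.comp (fderiv ℝ η x)) x :=
        Complex.ofRealCLM.hasFDerivAt.comp x (hη.differentiable (by simp) x).hasFDerivAt
      have h2 : (-∂_{(EuclideanSpace.single k 1 : RSpace d)} (hs'.toSchwartzMap hη')) x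
          = - fderiv ℝ (Complex.ofRealCLM ∘ η) x (EuclideanSpace.single k 1) := rfl
      rw [h2, h1.fderiv]
      simp
    · rfl

/-- On the Fourier side weak differentiation is multiplication by `2πi ξ_k`. -/
theorem isWeakPartial_iff_fourier {d : ℕ} (k : Fin d) (f h : LSpace d 2) :
    IsWeakPartial k f h ↔
      (𝓕 h : LSpace d 2) =ᵐ[volume] fun ξ => partialSymbol k ξ * (𝓕 f : LSpace d 2) ξ := by
  rw [isWeakPartial_iff_lineDeriv]
  have htg : (inner ℝ · (EuclideanSpace.single k 1 : RSpace d)).HasTemperateGrowth := by fun_prop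
  have h0 : ∂_{(EuclideanSpace.single k 1 : RSpace d)} (f : 𝓢'(RSpace d, ℂ)) = (h : 𝓢'(RSpace d, ℂ))
      ↔ (2 * Real.pi * Complex.I) • TemperedDistribution.smulLeftCLM ℂ
        (fun ξ : RSpace d => ((inner ℝ ξ (EuclideanSpace.single k 1 : RSpace d) : ℝ) : ℂ))
        ((𝓕 f : LSpace d 2) : 𝓢'(RSpace d, ℂ)) = ((𝓕 h : LSpace d 2) : 𝓢'(RSpace d, ℂ)) := by
    rw [← Lp.fourier_toTemperedDistribution_eq, ← Lp.fourier_toTemperedDistribution_eq,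
      ← TemperedDistribution.fourier_lineDerivOp_eq]
    exact (FourierTransform.fourierEquiv ℂ 𝓢'(RSpace d, ℂ)).injective.eq_iff.symm
  have h1 : ∀ ψ : 𝓢(RSpace d, ℂ), ((2 * Real.pi * Complex.I) • TemperedDistribution.smulLeftCLM ℂ
        (fun ξ : RSpace d => ((inner ℝ ξ (EuclideanSpace.single k 1 : RSpace d) : ℝ) : ℂ))
        ((𝓕 f : LSpace d 2) : 𝓢'(RSpace d, ℂ))) ψ
      = ∫ ξ, ψ ξ • (partialSymbol k ξ * (𝓕 f : LSpace d 2) ξ) := by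
    intro ψ
    have htg' : (fun ξ : RSpace d =>
      ((inner ℝ ξ (EuclideanSpace.single k 1 : RSpace d) : ℝ) : ℂ)).HasTemperateGrowth := by fun_prop
    change (2 * Real.pi * Complex.I) • TemperedDistribution.smulLeftCLM ℂ _ _ ψ = _
    rw [TemperedDistribution.smulLeftCLM_apply_apply, Lp.toTemperedDistribution_apply,
      smul_eq_mul, ← integral_const_mul]
    congr 1 with ξ
    rw [SchwartzMap.smulLeftCLM_apply_apply htg', inner_single_eq, partialSymbol]
    simp only [smul_eq_mul]
    ring
  rw [h0]
  constructor
  · intro he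
    have hL : LocallyIntegrable (fun ξ => partialSymbol k ξ * (𝓕 f : LSpace d 2) ξ) volume := by
      have := ((Lp.memLp (𝓕 f : LSpace d 2)).locallyIntegrable (by norm_num))
      exact (this.locallyIntegrableOn Set.univ).continuousOn_mul
        (continuous_partialSymbol k).continuousOn isOpen_univ.isLocallyClosed
        |> locallyIntegrableOn_univ.1
    refine ae_eq_of_integral_contDiff_smul_eq
      ((Lp.memLp (𝓕 h : LSpace d 2)).locallyIntegrable (by norm_num)) hL fun η hη hs => ?_
    have hs' : HasCompactSupport (Complex.ofRealCLM ∘ η) := hs.comp_left rfl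
    have hη' : ContDiff ℝ (⊤ : ℕ∞) (Complex.ofRealCLM ∘ η) := by fun_prop
    have := DFunLike.congr_fun he (hs'.toSchwartzMap hη')
    rw [h1, Lp.toTemperedDistribution_apply] at this
    exact this.symm
  · intro he
    ext ψ
    rw [h1, Lp.toTemperedDistribution_apply]
    refine integral_congr_ae ?_
    filter_upwards [he] with ξ hξ
    rw [hξ]

end

noncomputable section

open Filter Topology SchwartzMap LineDeriv
open scoped NNReal

/-- `‖v‖_∞ ≤ ‖v'‖_1` for compactly supported functions on the line. -/
theorem enorm_le_eLpNorm_fderiv_one_dim {F : Type*} [NormedAddCommGroup F] [NormedSpace ℝ F]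
    {v : RSpace 1 → F} (hv : ContDiff ℝ 1 v) (hs : HasCompactSupport v) (x : RSpace 1) :
    ‖v x‖ₑ ≤ eLpNorm (fderiv ℝ v) 1 volume := by
  let e : ℝ ≃L[ℝ] RSpace 1 :=
    (ContinuousLinearEquiv.funUnique (Fin 1) ℝ ℝ).symm.trans (EuclideanSpace.equiv (Fin 1) ℝ).symm
  have hmp : MeasurePreserving e volume volume :=
    (PiLp.volume_preserving_toLp (Fin 1)).comp
      (volume_preserving_funUnique (Fin 1) ℝ).symm
  have hne : ‖e 1‖ = 1 := by
    rw [EuclideanSpace.norm_eq]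
    simp [e]
  have hve : ContDiff ℝ 1 (v ∘ e) := hv.comp e.contDiff
  have hse : HasCompactSupport (v ∘ e) := hs.comp_homeomorph e.toHomeomorph
  have hder : ∀ y, ‖deriv (v ∘ e) y‖ₑ ≤ ‖fderiv ℝ v (e y)‖ₑ := fun y => by
    have : HasDerivAt (v ∘ e) (fderiv ℝ v (e y) (e 1)) y :=
      ((hv.differentiable one_ne_zero (e y)).hasFDerivAt).comp_hasDerivAt y
        (e : ℝ →L[ℝ] RSpace 1).hasDerivAt
    rw [this.deriv, ← ofReal_norm, ← ofReal_norm]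
    refine ENNReal.ofReal_le_ofReal ((ContinuousLinearMap.le_opNorm _ _).trans ?_)
    rw [hne, mul_one]
  calc ‖v x‖ₑ = ‖(v ∘ e) (e.symm x)‖ₑ := by simp
    _ ≤ ∫⁻ y in Set.Iic (e.symm x), ‖deriv (v ∘ e) y‖ₑ := hse.enorm_le_lintegral_Ici_deriv hve _
    _ ≤ ∫⁻ y, ‖deriv (v ∘ e) y‖ₑ := setLIntegral_le_lintegral _ _
    _ ≤ ∫⁻ y, ‖fderiv ℝ v (e y)‖ₑ := lintegral_mono hder
    _ = eLpNorm (fderiv ℝ v) 1 volume := by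
      rw [eLpNorm_one_eq_lintegral_enorm,
        hmp.lintegral_comp (hv.continuous_fderiv one_ne_zero).measurable.enorm]

theorem eLpNorm_fderiv_pow_le {d : ℕ} {u : RSpace d → ℂ} (hu : ContDiff ℝ 1 u) (s : ℕ) :
    eLpNorm (fderiv ℝ (fun x => u x ^ (s + 1))) 1 volume ≤
      (s + 1 : ℕ) * (eLpNorm (fun x => u x ^ s) 2 volume * eLpNorm (fderiv ℝ u) 2 volume) := by
  have hd : ∀ x, ‖fderiv ℝ (fun x => u x ^ (s + 1)) x‖ ≤
      ((s + 1 : ℕ) : ℝ) * ‖((fun x => u x ^ s) • fderiv ℝ u) x‖ := fun x => by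
    have := (hu.differentiable one_ne_zero x).hasFDerivAt.pow (s + 1)
    rw [this.fderiv, Pi.smul_apply', nsmul_eq_mul, norm_smul, norm_smul, norm_mul, Complex.norm_natCast,
      mul_assoc]
    simp
  refine (eLpNorm_le_mul_eLpNorm_of_ae_le_mul (Eventually.of_forall hd) 1).trans ?_
  rw [ENNReal.ofReal_natCast]
  gcongr
  exact eLpNorm_smul_le_mul_eLpNorm (hu.continuous_fderiv one_ne_zero).aestronglyMeasurable
    (hu.continuous.pow s).aestronglyMeasurable

theorem sobolev_test_top : ∃ C : ℝ≥0, ∀ u : RSpace 1 → ℂ, ContDiff ℝ 1 u → HasCompactSupport u →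
    eLpNorm u ⊤ volume ≤ C * (eLpNorm u 2 volume + eLpNorm (fderiv ℝ u) 2 volume) := by
  refine ⟨2, fun u hu hs => ?_⟩
  set A := eLpNorm u 2 volume + eLpNorm (fderiv ℝ u) 2 volume
  rw [eLpNorm_exponent_top]
  refine essSup_le_of_ae_le _ (Eventually.of_forall fun x => ?_)
  have h1 := enorm_le_eLpNorm_fderiv_one_dim (v := fun x => u x ^ (1 + 1)) (hu.pow _)
    (hs.comp_left (g := fun z : ℂ => z ^ (1 + 1)) (by simp)) x
  have h2 := h1.trans (eLpNorm_fderiv_pow_le hu 1)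
  simp only [pow_one] at h2
  have h3 : ‖u x‖ₑ ^ 2 ≤ ((2 : ℝ≥0) * A) ^ 2 := by
    rw [← enorm_pow]
    refine h2.trans ?_
    calc _ ≤ (2 : ℝ≥0∞) * (A * A) := by
          norm_num
          gcongr
          · exact le_self_add
          · exact le_add_self
      _ ≤ 4 * (A * A) := by gcongr; norm_num
      _ = _ := by rw [mul_pow]; norm_num; ring
  exact (ENNReal.pow_le_pow_left_iff two_ne_zero).1 h3

theorem sobolev_test_of_three_le {d : ℕ} (hd : 3 ≤ d) : ∃ C : ℝ≥0, ∀ u : RSpace d → ℂ,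
    ContDiff ℝ 1 u → HasCompactSupport u → eLpNorm u (ENNReal.ofReal (2 * d / (d - 2))) volume ≤
      C * (eLpNorm u 2 volume + eLpNorm (fderiv ℝ u) 2 volume) := by
  refine ⟨SNormLESNormFDerivOfEqConst ℂ (volume : Measure (RSpace d)) 2, fun u hu hs => ?_⟩
  have h3 : (3 : ℝ) ≤ d := by exact_mod_cast hd
  have := eLpNorm_le_eLpNorm_fderiv_of_eq (volume : Measure (RSpace d)) hu hs (p := 2)
    (p' := (2 * d / (d - 2) : ℝ).toNNReal) (by norm_num) (by simp; omega) (by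
      rw [Real.coe_toNNReal _ (div_nonneg (by positivity) (by linarith))]
      simp
      have : (d : ℝ) - 2 ≠ 0 := by linarith
      field_simp)
  refine this.trans ?_
  rw [NNReal.coe_ofNat, mul_add]
  exact le_add_self

/-- A one-step gain for powers, in terms of the bound `‖v‖_2 ≤ C ‖v'‖_1` or `‖v‖_∞ ≤ C ‖v'‖_1`. -/
theorem sobolev_test_pow {d : ℕ} (hd : d = 1 ∨ d = 2) (s : ℕ) : ∃ C : ℝ≥0, ∀ u : RSpace d → ℂ,
    ContDiff ℝ 1 u → HasCompactSupport u → eLpNorm (fun x => u x ^ (s + 1)) 2 volume ≤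
      C * (eLpNorm u 2 volume + eLpNorm (fderiv ℝ u) 2 volume) ^ (s + 1) := by
  induction s with
  | zero => exact ⟨1, fun u _ _ => by simp⟩
  | succ s ih =>
    obtain ⟨C, hC⟩ := ih
    rcases hd with rfl | rfl
    · obtain ⟨C', hC'⟩ := sobolev_test_top
      refine ⟨C' * C, fun u hu hs => ?_⟩
      have h1 : (fun x => u x ^ (s + 1 + 1)) = u • fun x => u x ^ (s + 1) := by
        ext x; simp [pow_succ']
      rw [h1]
      refine (eLpNorm_smul_le_mul_eLpNorm (p := ⊤) (q := 2)
        (hu.continuous.pow _).aestronglyMeasurable hu.continuous.aestronglyMeasurable).trans ?_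
      refine (mul_le_mul' (hC' u hu hs) (hC u hu hs)).trans (le_of_eq ?_)
      push_cast
      ring
    · refine ⟨eLpNormLESNormFDerivOneConst (volume : Measure (RSpace 2)) 2 * (s + 1 + 1 : ℕ) * C,
        fun u hu hs => ?_⟩
      have hc : NNReal.HolderConjugate (Module.finrank ℝ (RSpace 2)) 2 := by
        simp only [finrank_euclideanSpace, Fintype.card_fin]
        exact NNReal.HolderConjugate.two_two
      refine (eLpNorm_le_eLpNorm_fderiv_one (volume : Measure (RSpace 2))
        (u := fun x => u x ^ (s + 1 + 1)) (hu.pow _)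
        (hs.comp_left (g := fun z : ℂ => z ^ (s + 1 + 1)) (by simp)) hc).trans ?_
      refine (mul_le_mul_right ((eLpNorm_fderiv_pow_le hu (s + 1)).trans
        (mul_le_mul_right (mul_le_mul' (hC u hu hs) 
          (le_add_self (b := eLpNorm u 2 volume))) _)) _).trans (le_of_eq ?_)
      push_cast
      ring

theorem sobolev_test_even {d : ℕ} (hd : d = 1 ∨ d = 2) (s : ℕ) : ∃ C : ℝ≥0, ∀ u : RSpace d → ℂ,
    ContDiff ℝ 1 u → HasCompactSupport u →
      eLpNorm u (2 * ((s + 1 : ℕ) : ℝ≥0∞)) volume ≤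
        C * (eLpNorm u 2 volume + eLpNorm (fderiv ℝ u) 2 volume) := by
  obtain ⟨C, hC⟩ := sobolev_test_pow hd s
  refine ⟨C + 1, fun u hu hs => ?_⟩
  have h1 : eLpNorm (fun x => u x ^ (s + 1)) 2 volume
      = eLpNorm u (2 * ((s + 1 : ℕ) : ℝ≥0∞)) volume ^ (s + 1) := by
    have := eLpNorm_norm_rpow (p := 2) (μ := volume) u (q := ((s + 1 : ℕ) : ℝ)) (by positivity)
    rw [ENNReal.ofReal_natCast, ENNReal.rpow_natCast] at this
    rw [← this, ← eLpNorm_norm]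
    simp only [norm_pow, Real.rpow_natCast]
  have h2 := hC u hu hs
  rw [h1] at h2
  refine (ENNReal.pow_le_pow_left_iff (Nat.succ_ne_zero s)).1 (h2.trans ?_)
  rw [mul_pow]
  gcongr
  calc (C : ℝ≥0∞) ≤ ((C + 1 : ℝ≥0) : ℝ≥0∞) := by push_cast; exact le_self_add
    _ ≤ _ := le_self_pow₀ (by push_cast; exact le_add_self) (Nat.succ_ne_zero s)

theorem norm_le_sum_abs {d : ℕ} (ξ : RSpace d) : ‖ξ‖ ≤ ∑ k, |ξ k| := by
  conv_lhs => rw [← (EuclideanSpace.basisFun (Fin d) ℝ).sum_repr ξ]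
  refine (norm_sum_le _ _).trans (le_of_eq (Finset.sum_congr rfl fun k _ => ?_))
  rw [norm_smul]
  simp

theorem opNorm_le_sum {d : ℕ} (L : RSpace d →L[ℝ] ℂ) :
    ‖L‖ ≤ ∑ k, ‖L (EuclideanSpace.single k 1)‖ := by
  refine L.opNorm_le_bound (Finset.sum_nonneg fun _ _ => norm_nonneg _) fun x => ?_
  conv_lhs => rw [← (EuclideanSpace.basisFun (Fin d) ℝ).sum_repr x]
  rw [map_sum, Finset.sum_mul]
  refine (norm_sum_le _ _).trans (Finset.sum_le_sum fun k _ => ?_)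
  rw [map_smul, norm_smul, mul_comm]
  simp only [EuclideanSpace.basisFun_repr, EuclideanSpace.basisFun_apply]
  gcongr
  exact PiLp.norm_apply_le x k

/-- A Sobolev inequality for test functions extends to Schwartz functions. -/
theorem sobolev_schwartz {d : ℕ} {q : ℝ≥0∞} {C : ℝ≥0}
    (hC : ∀ u : RSpace d → ℂ, ContDiff ℝ 1 u → HasCompactSupport u →
      eLpNorm u q volume ≤ C * (eLpNorm u 2 volume + eLpNorm (fderiv ℝ u) 2 volume)) :
    ∃ C' : ℝ≥0, ∀ u : 𝓢(RSpace d, ℂ), eLpNorm u q volume ≤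
      C' * (eLpNorm u 2 volume + eLpNorm (fderiv ℝ u) 2 volume) := by
  obtain ⟨χ, K, hK, hsm, hcs, hle, hder, hev⟩ := exists_cutoff_sequence d
  lift K to ℝ≥0 using hK
  refine ⟨C * (1 + K), fun u => ?_⟩
  have hu1 : ContDiff ℝ 1 u := u.smooth 1
  have hc : ∀ n, ContDiff ℝ 1 (χ n) := fun n => (hsm n).of_le (by norm_cast)
  have hd : ∀ n x, ‖fderiv ℝ (fun x => χ n x • u x) x‖ ≤ ‖‖fderiv ℝ u x‖ + K * ‖u x‖‖ := by
    intro n x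
    rw [((((hc n).differentiable one_ne_zero x).hasFDerivAt).fun_smul
      (u.differentiableAt.hasFDerivAt)).fderiv]
    rw [Real.norm_of_nonneg (by positivity)]
    refine (norm_add_le _ _).trans (add_le_add ?_ ?_)
    · rw [norm_smul]
      exact mul_le_of_le_one_left (norm_nonneg _) (hle n x)
    · rw [ContinuousLinearMap.norm_smulRight_apply]
      gcongr
      exact hder n x
  have hb : ∀ n, eLpNorm (fun x => χ n x • u x) q volume ≤ (C * (1 + K) : ℝ≥0) *
      (eLpNorm u 2 volume + eLpNorm (fderiv ℝ u) 2 volume) := by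
    intro n
    have h1 := hC (fun x => χ n x • u x) ((hc n).smul hu1) (hcs n).smul_right
    have h2 : eLpNorm (fun x => χ n x • u x) 2 volume ≤ eLpNorm u 2 volume :=
      eLpNorm_mono fun x => by
        rw [norm_smul]
        exact mul_le_of_le_one_left (norm_nonneg _) (hle n x)
    have h3 : eLpNorm (fderiv ℝ (fun x => χ n x • u x)) 2 volume ≤
        eLpNorm (fderiv ℝ u) 2 volume + K * eLpNorm u 2 volume := by
      refine (eLpNorm_mono (hd n)).trans ?_
      refine (eLpNorm_add_le (f := fun x => ‖fderiv ℝ u x‖) (g := fun x => K * ‖u x‖)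
        (hu1.continuous_fderiv one_ne_zero).norm.aestronglyMeasurable
        (hu1.continuous.norm.const_mul _).aestronglyMeasurable (by norm_num)).trans ?_
      rw [eLpNorm_norm]
      gcongr
      refine (eLpNorm_le_mul_eLpNorm_of_ae_le_mul (g := u) (c := (K : ℝ))
        (Eventually.of_forall fun x => ?_) 2).trans ?_
      · simp
      · simp
    refine h1.trans ?_
    push_cast
    rw [mul_assoc]
    gcongr
    refine (add_le_add h2 h3).trans ?_
    calc _ = (1 + K) * eLpNorm u 2 volume + 1 * eLpNorm (fderiv ℝ u) 2 volume := by ring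
      _ ≤ (1 + K) * eLpNorm u 2 volume + (1 + K) * eLpNorm (fderiv ℝ u) 2 volume := by
        gcongr
        exact le_self_add
      _ = _ := by ring
  refine (Lp.eLpNorm_lim_le_liminf_eLpNorm (f := fun n x => χ n x • u x) (fun n =>
    ((hc n).smul hu1).continuous.aestronglyMeasurable) u
    (Eventually.of_forall fun x => ?_)).trans
    (liminf_le_of_frequently_le' (Frequently.of_forall hb))
  refine tendsto_const_nhds.congr' ?_
  filter_upwards [hev x] with n hn
  rw [hn.eq_of_nhds, one_smul]

end

noncomputable section

open Filter Topology SchwartzMap LineDeriv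
open scoped NNReal

theorem W1.isWeakPartial {d : ℕ} {r : ℝ≥0∞} [Fact (1 ≤ r)] (f : W1 d r) (k : Fin d) :
    IsWeakPartial k (W1.fn f) (W1.grad f k) := f.2 k

theorem W1.norm_fn_le {d : ℕ} {r : ℝ≥0∞} [Fact (1 ≤ r)] (f : W1 d r) : ‖W1.fn f‖ ≤ ‖f‖ :=
  norm_fst_le f.1

theorem W1.norm_grad_le {d : ℕ} {r : ℝ≥0∞} [Fact (1 ≤ r)] (f : W1 d r) (k : Fin d) :
    ‖W1.grad f k‖ ≤ ‖f‖ :=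
  (norm_le_pi_norm f.1.2 k).trans (norm_snd_le f.1)

theorem H1.fourier_grad {d : ℕ} (f : H1 d) (k : Fin d) :
    (𝓕 (W1.grad f k) : LSpace d 2) =ᵐ[volume]
      fun ξ => partialSymbol k ξ * (𝓕 (W1.fn f) : LSpace d 2) ξ :=
  (isWeakPartial_iff_fourier k _ _).1 (W1.isWeakPartial f k)

/-- The Bessel weight `(1 + |ξ|²)^s`. -/
def besselWeight {d : ℕ} (s : ℝ) (ξ : RSpace d) : ℂ := (((1 + ‖ξ‖ ^ 2) ^ s : ℝ) : ℂ)

theorem hasTemperateGrowth_besselWeight {d : ℕ} (s : ℝ) :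
    (besselWeight s : RSpace d → ℂ).HasTemperateGrowth := by
  unfold besselWeight
  fun_prop

theorem continuous_besselWeight {d : ℕ} (s : ℝ) : Continuous (besselWeight s : RSpace d → ℂ) :=
  (hasTemperateGrowth_besselWeight s).1.continuous

theorem norm_besselWeight {d : ℕ} (s : ℝ) (ξ : RSpace d) :
    ‖besselWeight s ξ‖ = (1 + ‖ξ‖ ^ 2) ^ s := by
  rw [besselWeight, Complex.norm_real, Real.norm_of_nonneg (by positivity)]

theorem norm_partialSymbol {d : ℕ} (k : Fin d) (ξ : RSpace d) :
    ‖partialSymbol k ξ‖ = 2 * Real.pi * |ξ k| := by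
  simp [partialSymbol, abs_of_pos Real.pi_pos]

theorem memLp_besselWeight_mul {d : ℕ} (f : H1 d) :
    MemLp (fun ξ => besselWeight (1 / 2) ξ * (𝓕 (W1.fn f) : LSpace d 2) ξ) 2 volume := by
  have hg : MemLp (fun ξ => ‖(𝓕 (W1.fn f) : LSpace d 2) ξ‖ +
      ∑ k, ‖(𝓕 (W1.grad f k) : LSpace d 2) ξ‖) 2 volume :=
    (Lp.memLp _).norm.add (memLp_finsetSum _ fun k _ => (Lp.memLp _).norm)
  refine hg.of_le ((continuous_besselWeight _).aestronglyMeasurable.mul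
    (Lp.aestronglyMeasurable _)) ?_
  have hall : ∀ᵐ ξ ∂(volume : Measure (RSpace d)), ∀ k, (𝓕 (W1.grad f k) : LSpace d 2) ξ =
      partialSymbol k ξ * (𝓕 (W1.fn f) : LSpace d 2) ξ :=
    ae_all_iff.2 fun k => H1.fourier_grad f k
  filter_upwards [hall] with ξ hξ
  rw [Real.norm_of_nonneg (by positivity), norm_mul, norm_besselWeight]
  have h1 : (1 + ‖ξ‖ ^ 2) ^ (1 / 2 : ℝ) ≤ 1 + ∑ k, ‖partialSymbol k ξ‖ := by
    rw [← Real.sqrt_eq_rpow]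
    have h2 : ‖ξ‖ ≤ ∑ k, ‖partialSymbol k ξ‖ := by
      refine (norm_le_sum_abs ξ).trans (Finset.sum_le_sum fun k _ => ?_)
      rw [norm_partialSymbol]
      nlinarith [Real.pi_gt_three, abs_nonneg (ξ k)]
    calc √(1 + ‖ξ‖ ^ 2) ≤ 1 + ‖ξ‖ :=
          Real.sqrt_le_iff.2 ⟨by positivity, by nlinarith [norm_nonneg ξ]⟩
      _ ≤ _ := by gcongr
  calc _ ≤ (1 + ∑ k, ‖partialSymbol k ξ‖) * ‖(𝓕 (W1.fn f) : LSpace d 2) ξ‖ := by gcongr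
    _ = _ := by
      rw [add_mul, one_mul, Finset.sum_mul]
      simp only [hξ, norm_mul]

theorem fourierInv_dist_eq {d : ℕ} (f g : LSpace d 2) : ‖𝓕⁻ f - g‖ = ‖f - 𝓕 g‖ := by
  rw [← Lp.norm_fourier_eq (𝓕⁻ f - g), sub_eq_add_neg, FourierTransform.fourier_add]
  rw [← neg_one_smul ℂ g, FourierTransform.fourier_smul, neg_one_smul, ← sub_eq_add_neg,
    FourierTransform.fourier_fourierInv_eq]

theorem norm_sub_le_of_ae {d : ℕ} {a b a' b' : LSpace d 2} {C : ℝ}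
    (h : ∀ᵐ ξ ∂(volume : Measure (RSpace d)), ‖a ξ - b ξ‖ ≤ C * ‖a' ξ - b' ξ‖) :
    ‖a - b‖ ≤ C * ‖a' - b'‖ := by
  refine Lp.norm_le_mul_norm_of_ae_le_mul ?_
  filter_upwards [h, Lp.coeFn_sub a b, Lp.coeFn_sub a' b'] with ξ h1 h2 h3
  rw [h2, h3]
  exact h1

theorem fourier_toLp_ae {d : ℕ} (u : 𝓢(RSpace d, ℂ)) :
    (𝓕 (u.toLp 2 volume) : LSpace d 2) =ᵐ[volume] (𝓕 u : 𝓢(RSpace d, ℂ)) := by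
  rw [SchwartzMap.toLp_fourier_eq]
  exact SchwartzMap.coeFn_toLp _ _ _

/-- Schwartz functions are dense in `H¹`. -/
theorem H1.exists_schwartz_near {d : ℕ} (f : H1 d) {ε : ℝ} (hε : 0 < ε) :
    ∃ u : 𝓢(RSpace d, ℂ), ‖u.toLp 2 volume - W1.fn f‖ ≤ ε ∧
      ∀ k, ‖(∂_{(EuclideanSpace.single k 1 : RSpace d)} u).toLp 2 volume - W1.grad f k‖ ≤ ε := by
  have hG := memLp_besselWeight_mul f
  set G : LSpace d 2 := hG.toLp _
  have hδ : 0 < ε / (2 * Real.pi + 1) := by positivity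
  have hdense := SchwartzMap.denseRange_toLpCLM (E := RSpace d) (F := ℂ) (p := 2)
    (μ := (volume : Measure (RSpace d))) (by simp)
  obtain ⟨_, ⟨g, rfl⟩, hg⟩ := Metric.mem_closure_iff.1 (hdense G) _ hδ
  rw [SchwartzMap.toLpCLM_apply, dist_eq_norm, norm_sub_rev] at hg
  have hgε : (2 * Real.pi + 1) * ‖g.toLp 2 volume - G‖ ≤ ε := by
    rw [lt_div_iff₀ (by positivity)] at hg
    linarith
  set v : 𝓢(RSpace d, ℂ) := SchwartzMap.smulLeftCLM ℂ (besselWeight (-(1 / 2))) g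
  have hv : ∀ ξ, v ξ = besselWeight (-(1 / 2)) ξ * g ξ := fun ξ =>
    SchwartzMap.smulLeftCLM_apply_apply (hasTemperateGrowth_besselWeight _) g ξ
  have hw : ∀ ξ : RSpace d, besselWeight (-(1 / 2)) ξ * besselWeight (1 / 2) ξ = 1 := fun ξ => by
    rw [besselWeight, besselWeight, ← Complex.ofReal_mul, ← Real.rpow_add (by positivity)]
    simp
  have hsq : ∀ ξ : RSpace d, (1 + ‖ξ‖ ^ 2) ^ (-(1 / 2) : ℝ) = (√(1 + ‖ξ‖ ^ 2))⁻¹ := fun ξ => by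
    rw [Real.rpow_neg (by positivity), Real.sqrt_eq_rpow]
  have hs1 : ∀ ξ : RSpace d, 1 ≤ √(1 + ‖ξ‖ ^ 2) := fun ξ => by
    rw [Real.one_le_sqrt]
    nlinarith [sq_nonneg ‖ξ‖]
  have hs2 : ∀ ξ : RSpace d, ‖ξ‖ ≤ √(1 + ‖ξ‖ ^ 2) := fun ξ =>
    Real.le_sqrt_of_sq_le (by linarith)
  have hgG : ∀ᵐ ξ ∂(volume : Measure (RSpace d)),
      v ξ - (𝓕 (W1.fn f) : LSpace d 2) ξ
        = besselWeight (-(1 / 2)) ξ * (g.toLp 2 volume ξ - G ξ) := by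
    filter_upwards [g.coeFn_toLp 2 volume, hG.coeFn_toLp] with ξ h1 h2
    rw [h1, h2, hv, mul_sub, ← mul_assoc, hw, one_mul]
  refine ⟨𝓕⁻ v, ?_, fun k => ?_⟩
  · rw [← SchwartzMap.toLp_fourierInv_eq, fourierInv_dist_eq]
    have h1 : ‖v.toLp 2 volume - 𝓕 (W1.fn f)‖ ≤ 1 * ‖g.toLp 2 volume - G‖ := by
      refine norm_sub_le_of_ae ?_
      filter_upwards [hgG, v.coeFn_toLp 2 volume] with ξ h1 h2
      rw [h2, h1, norm_mul, norm_besselWeight, hsq]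
      gcongr
      exact inv_le_one_of_one_le₀ (hs1 ξ)
    have h2 : (1 : ℝ) ≤ 2 * Real.pi + 1 := by linarith [Real.pi_pos]
    exact h1.trans ((mul_le_mul_of_nonneg_right h2 (norm_nonneg _)).trans hgε)
  · rw [← Lp.norm_fourier_eq, sub_eq_add_neg, FourierTransform.fourier_add,
      ← neg_one_smul ℂ (W1.grad f k), FourierTransform.fourier_smul, neg_one_smul, ← sub_eq_add_neg]
    have h1 : ‖𝓕 ((∂_{(EuclideanSpace.single k 1 : RSpace d)} (𝓕⁻ v)).toLp 2 volume)
        - 𝓕 (W1.grad f k)‖ ≤ (2 * Real.pi) * ‖g.toLp 2 volume - G‖ := by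
      refine norm_sub_le_of_ae ?_
      filter_upwards [hgG, fourier_toLp_ae (∂_{(EuclideanSpace.single k 1 : RSpace d)} (𝓕⁻ v)),
        H1.fourier_grad f k] with ξ h1 h2 h3
      have h4 : (𝓕 (∂_{(EuclideanSpace.single k 1 : RSpace d)} (𝓕⁻ v)) : 𝓢(RSpace d, ℂ)) ξ
          = partialSymbol k ξ * v ξ := by
        rw [SchwartzMap.fourier_lineDerivOp_eq, smul_apply,
          SchwartzMap.smulLeftCLM_apply_apply (by fun_prop), inner_single_eq,
          FourierTransform.fourier_fourierInv_eq, partialSymbol]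
        simp [mul_assoc]
      rw [h2, h3, h4, ← mul_sub, h1, ← mul_assoc, norm_mul, norm_mul, norm_partialSymbol,
        norm_besselWeight, hsq, mul_assoc (2 * Real.pi)]
      have h5 : |ξ k| * (√(1 + ‖ξ‖ ^ 2))⁻¹ ≤ 1 := by
        rw [mul_inv_le_iff₀ (by linarith [hs1 ξ]), one_mul]
        exact (PiLp.norm_apply_le ξ k).trans (hs2 ξ)
      exact mul_le_mul_of_nonneg_right (mul_le_of_le_one_right (by positivity) h5) (norm_nonneg _)
    have h2 : 2 * Real.pi ≤ 2 * Real.pi + 1 := by linarith [Real.pi_pos]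
    exact h1.trans ((mul_le_mul_of_nonneg_right h2 (norm_nonneg _)).trans hgε)

/-- The Sobolev embedding `H¹ ⊂ L^q`. -/
def SobolevEmbedding (d : ℕ) (q : ℝ≥0∞) : Prop :=
  ∃ C : ℝ≥0, ∀ f : H1 d, eLpNorm (W1.fn f) q volume ≤ C * ‖f‖ₑ

theorem eLpNorm_schwartz_eq {d : ℕ} (u : 𝓢(RSpace d, ℂ)) :
    eLpNorm u 2 volume = ‖u.toLp 2 volume‖ₑ := by
  rw [Lp.enorm_def]
  exact eLpNorm_congr_ae (u.coeFn_toLp 2 volume).symm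

theorem eLpNorm_fderiv_schwartz_le {d : ℕ} (u : 𝓢(RSpace d, ℂ)) :
    eLpNorm (fderiv ℝ u) 2 volume ≤
      ∑ k, ‖(∂_{(EuclideanSpace.single k 1 : RSpace d)} u).toLp 2 volume‖ₑ := by
  have h1 : eLpNorm (fderiv ℝ u) 2 volume ≤ eLpNorm (∑ k : Fin d,
      fun x => ‖(∂_{(EuclideanSpace.single k 1 : RSpace d)} u) x‖) 2 volume := by
    refine eLpNorm_mono fun x => ?_
    rw [Finset.sum_apply, Real.norm_of_nonneg (Finset.sum_nonneg fun _ _ => norm_nonneg _)]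
    exact opNorm_le_sum _
  refine h1.trans ((eLpNorm_sum_le (fun k _ =>
    (SchwartzMap.continuous _).norm.aestronglyMeasurable) (by norm_num)).trans ?_)
  refine Finset.sum_le_sum fun k _ => ?_
  rw [eLpNorm_norm, eLpNorm_schwartz_eq]

theorem sobolevEmbedding_of_test {d : ℕ} {q : ℝ≥0∞} {C : ℝ≥0}
    (hC : ∀ u : RSpace d → ℂ, ContDiff ℝ 1 u → HasCompactSupport u →
      eLpNorm u q volume ≤ C * (eLpNorm u 2 volume + eLpNorm (fderiv ℝ u) 2 volume)) :
    SobolevEmbedding d q := by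
  obtain ⟨C', hC'⟩ := sobolev_schwartz hC
  refine ⟨C' * (1 + d), fun f => ?_⟩
  have hpos : ∀ n : ℕ, (0 : ℝ) < 1 / ((n : ℝ) + 1) := fun n => Nat.one_div_pos_of_nat
  choose u hu hdu using fun n : ℕ => H1.exists_schwartz_near f (hpos n)
  have hlim : Tendsto (fun n => (u n).toLp 2 volume) atTop (𝓝 (W1.fn f)) :=
    tendsto_iff_norm_sub_tendsto_zero.2 (squeeze_zero (fun _ => norm_nonneg _) hu
      tendsto_one_div_add_atTop_nhds_zero_nat)
  have hlimd : ∀ k, Tendsto (fun n => (∂_{(EuclideanSpace.single k 1 : RSpace d)} (u n)).toLp 2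
      volume) atTop (𝓝 (W1.grad f k)) := fun k =>
    tendsto_iff_norm_sub_tendsto_zero.2 (squeeze_zero (fun _ => norm_nonneg _) (fun n => hdu n k)
      tendsto_one_div_add_atTop_nhds_zero_nat)
  obtain ⟨ns, hns, hae⟩ := (tendstoInMeasure_of_tendsto_Lp hlim).exists_seq_tendsto_ae
  refine (Lp.eLpNorm_lim_le_liminf_eLpNorm (f := fun n => (u (ns n)).toLp 2 volume)
    (fun n => Lp.aestronglyMeasurable _) _ hae).trans ?_
  have hb : ∀ n, eLpNorm ((u (ns n)).toLp 2 volume) q volume ≤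
      C' * (‖(u (ns n)).toLp 2 volume‖ₑ + ∑ k,
        ‖(∂_{(EuclideanSpace.single k 1 : RSpace d)} (u (ns n))).toLp 2 volume‖ₑ) := fun n => by
    rw [eLpNorm_congr_ae ((u (ns n)).coeFn_toLp 2 volume), ← eLpNorm_schwartz_eq]
    exact (hC' _).trans (by gcongr; exact eLpNorm_fderiv_schwartz_le _)
  refine (liminf_le_liminf (Eventually.of_forall hb)).trans ?_
  have hl : Tendsto (fun n => C' * (‖(u (ns n)).toLp 2 volume‖ₑ + ∑ k,
        ‖(∂_{(EuclideanSpace.single k 1 : RSpace d)} (u (ns n))).toLp 2 volume‖ₑ)) atTop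
      (𝓝 (C' * (‖W1.fn f‖ₑ + ∑ k, ‖W1.grad f k‖ₑ))) := by
    refine ENNReal.Tendsto.const_mul (Tendsto.add ?_ (tendsto_finsetSum _ fun k _ => ?_))
      (Or.inr ENNReal.coe_ne_top)
    · exact (hlim.comp hns.tendsto_atTop).enorm
    · exact ((hlimd k).comp hns.tendsto_atTop).enorm
  rw [hl.liminf_eq]
  push_cast
  rw [mul_assoc]
  gcongr
  rw [add_mul, one_mul]
  have hle : ∀ g : LSpace d 2, ‖g‖ ≤ ‖f‖ → ‖g‖ₑ ≤ ‖f‖ₑ := fun g h => by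
    rw [← ofReal_norm, ← ofReal_norm]
    exact ENNReal.ofReal_le_ofReal h
  refine add_le_add (hle _ (W1.norm_fn_le f)) ?_
  refine (Finset.sum_le_sum fun k _ => hle _ (W1.norm_grad_le f k)).trans ?_
  simp

end

noncomputable section

open Filter Topology
open scoped NNReal

/-- Interpolation of `L^p` norms between `L²` and `L^q`. -/
theorem eLpNorm_interpolate {α E : Type*} [MeasurableSpace α] {μ : Measure α}
    [NormedAddCommGroup E] {p q : ℝ} (hp : 2 < p) (hq : p < q) :
    ∃ a : ℝ, 0 < a ∧ a < 1 ∧ ∀ f : α → E, AEStronglyMeasurable f μ →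
      eLpNorm f (ENNReal.ofReal p) μ ≤
        eLpNorm f 2 μ ^ a * eLpNorm f (ENNReal.ofReal q) μ ^ (1 - a) := by
  have hq2 : 0 < q - 2 := by linarith
  have hp0 : 0 < p := by linarith
  have hq0 : 0 < q := by linarith
  set θ := (p - 2) / (q - 2) with hθ
  have hθ0 : 0 < θ := div_pos (by linarith) hq2
  have hθ1 : θ < 1 := (div_lt_one hq2).2 (by linarith)
  have hpθ : p = 2 * (1 - θ) + q * θ := by
    rw [hθ]; field_simp; ring
  have h1a : 1 - 2 * (1 - θ) / p = q * θ / p := by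
    field_simp; linarith
  refine ⟨2 * (1 - θ) / p, by have := sub_pos.2 hθ1; positivity, ?_, fun f hf => ?_⟩
  · have : 0 < q * θ / p := by positivity
    linarith
  have hN : ∀ r : ℝ, 0 < r → eLpNorm f (ENNReal.ofReal r) μ = (∫⁻ x, ‖f x‖ₑ ^ r ∂μ) ^ (1 / r) :=
    fun r hr => by
      rw [eLpNorm_eq_lintegral_rpow_enorm_toReal (by simpa using hr) ENNReal.ofReal_ne_top,
        ENNReal.toReal_ofReal hr.le]
  have h2 : eLpNorm f 2 μ = (∫⁻ x, ‖f x‖ₑ ^ (2 : ℝ) ∂μ) ^ (1 / 2 : ℝ) := by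
    rw [← hN 2 two_pos]; norm_num
  have key := ENNReal.lintegral_mul_norm_pow_le (μ := μ) (f := fun x => ‖f x‖ₑ ^ (2 : ℝ))
    (g := fun x => ‖f x‖ₑ ^ q) (hf.enorm.pow_const _) (hf.enorm.pow_const _)
    (sub_pos.2 hθ1).le hθ0.le (by ring)
  have hpt : ∀ x, (‖f x‖ₑ ^ (2 : ℝ)) ^ (1 - θ) * (‖f x‖ₑ ^ q) ^ θ = ‖f x‖ₑ ^ p := fun x => by
    rw [← ENNReal.rpow_mul, ← ENNReal.rpow_mul, ← ENNReal.rpow_add_of_nonneg, ← hpθ]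
    · have := sub_pos.2 hθ1; positivity
    · positivity
  simp only [hpt] at key
  rw [h1a, hN p hp0, hN q hq0, h2]
  refine (ENNReal.rpow_le_rpow key (by positivity : 0 ≤ 1 / p)).trans (le_of_eq ?_)
  rw [ENNReal.mul_rpow_of_nonneg _ _ (by positivity), ← ENNReal.rpow_mul, ← ENNReal.rpow_mul,
    ← ENNReal.rpow_mul, ← ENNReal.rpow_mul]
  congr 2 <;> field_simp

theorem SobolevEmbedding.interpolate {d : ℕ} {p q : ℝ} (hp : 2 < p) (hq : p < q)
    (h : SobolevEmbedding d (ENNReal.ofReal q)) : SobolevEmbedding d (ENNReal.ofReal p) := by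
  obtain ⟨C, hC⟩ := h
  obtain ⟨a, ha0, ha1, ha⟩ := eLpNorm_interpolate (E := ℂ) (μ := (volume : Measure (RSpace d))) hp hq
  refine ⟨C ^ (1 - a), fun f => (ha _ (Lp.aestronglyMeasurable _)).trans ?_⟩
  have h2 : eLpNorm (W1.fn f) 2 volume ≤ ‖f‖ₑ := by
    rw [← Lp.enorm_def, ← ofReal_norm, ← ofReal_norm]
    exact ENNReal.ofReal_le_ofReal (W1.norm_fn_le f)
  calc _ ≤ ‖f‖ₑ ^ a * (C * ‖f‖ₑ) ^ (1 - a) := by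
        gcongr
        exact hC f
    _ = C ^ (1 - a) * (‖f‖ₑ ^ a * ‖f‖ₑ ^ (1 - a)) := by
        rw [ENNReal.mul_rpow_of_nonneg _ _ (by linarith)]; ring
    _ = _ := by
        rw [← ENNReal.rpow_add_of_nonneg _ _ ha0.le (by linarith),
          ENNReal.coe_rpow_of_nonneg _ (by linarith : 0 ≤ 1 - a)]
        simp

theorem exists_sobolevEmbedding_gt {d : ℕ} (hd : 1 ≤ d) {p : ℝ} (hp : 2 < p)
    (hc : ENNReal.ofReal p < critExp d) :
    ∃ q, p < q ∧ SobolevEmbedding d (ENNReal.ofReal q) := by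
  by_cases h2 : d ≤ 2
  · obtain ⟨s, hs⟩ := exists_nat_gt p
    refine ⟨2 * (s + 1 : ℕ), by push_cast; linarith, ?_⟩
    obtain ⟨C, hC⟩ := sobolev_test_even (d := d) (by omega) s
    rw [ENNReal.ofReal_mul two_pos.le, ENNReal.ofReal_natCast, ENNReal.ofReal_ofNat]
    exact sobolevEmbedding_of_test hC
  · rw [critExp, if_neg h2] at hc
    obtain ⟨C, hC⟩ := sobolev_test_of_three_le (d := d) (by omega)
    exact ⟨_, (ENNReal.ofReal_lt_ofReal_iff_of_nonneg (by linarith)).1 hc,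
      sobolevEmbedding_of_test hC⟩

theorem sobolevEmbedding_spaceExp {d : ℕ} (hd : 1 ≤ d) {p : ℝ} (hp : 2 < p)
    (hc : ENNReal.ofReal p < critExp d) : SobolevEmbedding d (spaceExp d p) := by
  unfold spaceExp
  split_ifs with h1 h2
  · subst h1
    obtain ⟨C, hC⟩ := sobolev_test_top
    exact sobolevEmbedding_of_test hC
  · obtain ⟨q, hq, h⟩ := exists_sobolevEmbedding_gt hd hp hc
    exact h.interpolate hp hq
  · rw [critExp, if_neg (by omega)]
    obtain ⟨C, hC⟩ := sobolev_test_of_three_le (d := d) (by omega)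
    exact sobolevEmbedding_of_test hC

theorem SobolevEmbedding.memLp {d : ℕ} {q : ℝ≥0∞} (h : SobolevEmbedding d q) (f : H1 d) :
    MemLp (W1.fn f) q volume := by
  obtain ⟨C, hC⟩ := h
  exact ⟨Lp.aestronglyMeasurable _, (hC f).trans_lt (ENNReal.mul_lt_top ENNReal.coe_lt_top
    enorm_lt_top)⟩

/-! ### Homogeneous functions -/

section Homogeneous

variable {E E' : Type*} [NormedAddCommGroup E] [NormedSpace ℝ E]
  [NormedAddCommGroup E'] [NormedSpace ℝ E']

/-- Positive homogeneity of degree `α`. -/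
def PosHomogeneous (α : ℝ) (f : E → E') : Prop :=
  ∀ (z : E) (r : ℝ), 0 < r → f (r • z) = r ^ α • f z

theorem PosHomogeneous.fderiv {α : ℝ} {f : E → E'} (h : PosHomogeneous α f)
    (hf : Differentiable ℝ f) : PosHomogeneous (α - 1) (fderiv ℝ f) := by
  intro z r hr
  have h1 : _root_.fderiv ℝ (fun z => f (r • z)) z = r • _root_.fderiv ℝ f (r • z) :=
    fderiv_comp_smul _
  have h2 : _root_.fderiv ℝ (fun z => f (r • z)) z = r ^ α • _root_.fderiv ℝ f z := by
    rw [funext fun z => h z r hr]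
    exact fderiv_fun_const_smul (hf z) _
  rw [h1] at h2
  rw [Real.rpow_sub_one hr.ne', div_eq_inv_mul, mul_smul, ← h2, inv_smul_smul₀ hr.ne']

theorem PosHomogeneous.norm_le [FiniteDimensional ℝ E] {α : ℝ} (hα : 0 < α) {f : E → E'}
    (h : PosHomogeneous α f) (hf : Continuous f) : ∃ C, 0 ≤ C ∧ ∀ z, ‖f z‖ ≤ C * ‖z‖ ^ α := by
  have : ProperSpace E := FiniteDimensional.proper_real E
  have h0 : f 0 = 0 := by
    have h2 := h 0 2 two_pos
    rw [smul_zero] at h2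
    have h3 : ((2 : ℝ) ^ α - 1) • f 0 = 0 := by rw [sub_smul, one_smul, ← h2, sub_self]
    refine (smul_eq_zero.1 h3).resolve_left ?_
    have := Real.one_lt_rpow one_lt_two hα
    linarith
  obtain ⟨C, hC⟩ := (isCompact_sphere (0 : E) 1).exists_bound_of_continuousOn hf.continuousOn
  refine ⟨max C 0, le_max_right _ _, fun z => ?_⟩
  by_cases hz : z = 0
  · rw [hz, h0, norm_zero]; positivity
  · have hn : 0 < ‖z‖ := norm_pos_iff.2 hz
    have h1 : f z = ‖z‖ ^ α • f (‖z‖⁻¹ • z) := by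
      rw [← h _ _ hn, smul_inv_smul₀ hn.ne']
    rw [h1, norm_smul, Real.norm_of_nonneg (by positivity), mul_comm]
    gcongr
    refine (hC _ ?_).trans (le_max_left _ _)
    simp [norm_smul, hn.ne']

end Homogeneous

theorem potential_bounds {d N : ℕ} {g : (Fin N → ℂ) → ℝ} {p : ℝ}
    (hg : HomogeneousPotential d N g p) : ∃ C, 0 ≤ C ∧
      (∀ z, |g z| ≤ C * ‖z‖ ^ p) ∧ (∀ z, ‖fderiv ℝ g z‖ ≤ C * ‖z‖ ^ (p - 1)) ∧
      ∀ z w, ‖fderiv ℝ g z - fderiv ℝ g w‖ ≤ C * (‖z‖ ^ (p - 2) + ‖w‖ ^ (p - 2)) * ‖z - w‖ := by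
  have hp := hg.two_lt
  have hh : PosHomogeneous p g := fun z r hr => by
    rw [smul_eq_mul, ← hg.homogeneous z r hr.le]
    congr 1
  have hd : Differentiable ℝ g := hg.contDiff.differentiable two_ne_zero
  have h1 := hh.fderiv hd
  have hc1 : ContDiff ℝ 1 (fderiv ℝ g) := hg.contDiff.fderiv_right (by norm_num)
  have hd1 : Differentiable ℝ (fderiv ℝ g) := hc1.differentiable one_ne_zero
  have h2 := h1.fderiv hd1
  rw [sub_sub, one_add_one_eq_two] at h2
  obtain ⟨C0, hC0, hb0⟩ := hh.norm_le (by linarith) hd.continuous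
  obtain ⟨C1, hC1, hb1⟩ := h1.norm_le (by linarith) hc1.continuous
  obtain ⟨C2, hC2, hb2⟩ := h2.norm_le (by linarith) (hc1.continuous_fderiv one_ne_zero)
  refine ⟨C0 + C1 + C2, by positivity, fun z => (hb0 z).trans ?_, fun z => (hb1 z).trans ?_,
    fun z w => ?_⟩
  · gcongr; linarith
  · gcongr; linarith
  · have hseg : ∀ x ∈ segment ℝ w z, ‖fderiv ℝ (fderiv ℝ g) x‖ ≤
        (C0 + C1 + C2) * (‖z‖ ^ (p - 2) + ‖w‖ ^ (p - 2)) := by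
      intro x hx
      have hx' : ‖x‖ ≤ max ‖w‖ ‖z‖ := by
        have hm : segment ℝ w z ⊆ Metric.closedBall 0 (max ‖w‖ ‖z‖) :=
          (convex_closedBall _ _).segment_subset (by simp) (by simp)
        simpa using hm hx
      refine (hb2 x).trans ?_
      have h3 : ‖x‖ ^ (p - 2) ≤ ‖z‖ ^ (p - 2) + ‖w‖ ^ (p - 2) := by
        refine (Real.rpow_le_rpow (norm_nonneg _) hx' (by linarith)).trans ?_
        rcases max_choice ‖w‖ ‖z‖ with h | h <;> rw [h]
        · have : 0 ≤ ‖z‖ ^ (p - 2) := by positivity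
          linarith
        · have : 0 ≤ ‖w‖ ^ (p - 2) := by positivity
          linarith
      gcongr
      linarith
    exact (convex_segment w z).norm_image_sub_le_of_norm_fderiv_le (fun x _ => hd1 x) hseg
      (left_mem_segment ℝ w z) (right_mem_segment ℝ w z)

end

noncomputable section

open Filter Topology ComplexConjugate
open scoped NNReal

/-! ### The nonlinearity -/

theorem nonlin_sub_le {N : ℕ} {g : (Fin N → ℂ) → ℝ} {p : ℝ} (hp : 2 < p) (j : Fin N)
    (z w : Fin N → ℂ) : ‖nonlin g p j z - nonlin g p j w‖ ≤ ‖fderiv ℝ g z - fderiv ℝ g w‖ := by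
  set L := fderiv ℝ g z - fderiv ℝ g w with hL
  have h1 : nonlin g p j z - nonlin g p j w = ((2 / p : ℝ) : ℂ) * ((1 / 2 : ℂ) *
      ((L (Pi.single j 1) : ℂ) + Complex.I * (L (Pi.single j Complex.I) : ℂ))) := by
    simp only [nonlin, wirtingerBar, hL, sub_apply]
    push_cast
    ring
  have h2 : ∀ c : ℂ, ‖c‖ = 1 → ‖(L (Pi.single j c) : ℂ)‖ ≤ ‖L‖ := fun c hc => by
    rw [Complex.norm_real]
    have hn : ‖(Pi.single j c : Fin N → ℂ)‖ = 1 := by rw [Pi.norm_single, hc]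
    simpa [hn] using L.le_opNorm (Pi.single j c)
  have h3 : 2 / p ≤ 1 := by rw [div_le_one (by linarith)]; exact hp.le
  have h4 : 0 ≤ 2 / p := by positivity
  rw [h1, norm_mul, norm_mul, Complex.norm_real, Real.norm_of_nonneg h4]
  have h5 : ‖(L (Pi.single j 1) : ℂ) + Complex.I * (L (Pi.single j Complex.I) : ℂ)‖ ≤ 2 * ‖L‖ := by
    refine (norm_add_le _ _).trans ?_
    rw [norm_mul, Complex.norm_I, one_mul]
    linarith [h2 1 (by simp), h2 Complex.I (by simp)]
  have h6 : ‖(1 / 2 : ℂ)‖ = 1 / 2 := by simp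
  rw [h6]
  calc _ ≤ 1 * (1 / 2 * (2 * ‖L‖)) := by gcongr
    _ = _ := by ring

theorem fderiv_potential_zero {d N : ℕ} {g : (Fin N → ℂ) → ℝ} {p : ℝ}
    (hg : HomogeneousPotential d N g p) : fderiv ℝ g 0 = 0 := by
  obtain ⟨C, _, _, h, _⟩ := potential_bounds hg
  have := h 0
  rw [norm_zero, Real.zero_rpow (by linarith [hg.two_lt]), mul_zero] at this
  exact norm_le_zero_iff.1 this

theorem nonlin_le {d N : ℕ} {g : (Fin N → ℂ) → ℝ} {p : ℝ}
    (hg : HomogeneousPotential d N g p) (j : Fin N) (z : Fin N → ℂ) :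
    ‖nonlin g p j z‖ ≤ ‖fderiv ℝ g z‖ := by
  have h0 : nonlin g p j 0 = 0 := by simp [nonlin, wirtingerBar, fderiv_potential_zero hg]
  simpa [h0, fderiv_potential_zero hg] using nonlin_sub_le (g := g) hg.two_lt j z 0

theorem continuous_nonlin {d N : ℕ} {g : (Fin N → ℂ) → ℝ} {p : ℝ}
    (hg : HomogeneousPotential d N g p) (j : Fin N) : Continuous (nonlin g p j) := by
  have h : Continuous (fderiv ℝ g) := hg.contDiff.continuous_fderiv two_ne_zero
  unfold nonlin wirtingerBar
  have h1 : ∀ v, Continuous fun z => fderiv ℝ g z v := fun v => h.clm_apply continuous_const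
  exact continuous_const.mul (continuous_const.mul
    ((Complex.continuous_ofReal.comp (h1 _)).add
      (continuous_const.mul (Complex.continuous_ofReal.comp (h1 _)))))

theorem fderiv_potential_eq {N : ℕ} {g : (Fin N → ℂ) → ℝ} {p : ℝ} (hp : p ≠ 0)
    (z w : Fin N → ℂ) :
    1 / p * fderiv ℝ g z w = ∑ j, (conj (w j) * nonlin g p j z).re := by
  have h1 : w = ∑ j, ((w j).re • (Pi.single j 1 : Fin N → ℂ)
      + (w j).im • (Pi.single j Complex.I : Fin N → ℂ)) := by
    conv_lhs => rw [← Finset.univ_sum_single w]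
    refine Finset.sum_congr rfl fun j _ => ?_
    rw [← Pi.single_smul, ← Pi.single_smul, ← Pi.single_add]
    congr 1
    simp [Complex.re_add_im]
  conv_lhs => rw [h1]
  rw [map_sum, Finset.mul_sum]
  refine Finset.sum_congr rfl fun j _ => ?_
  rw [map_add, map_smul, map_smul, nonlin, wirtingerBar]
  simp [Complex.mul_re, Complex.mul_im]
  field_simp

/-! ### Vector-valued functions -/

/-- The `ℂ^N`-valued function with components in `H¹`. -/
def H1.vec {d N : ℕ} (u : Fin N → H1 d) (x : RSpace d) : Fin N → ℂ := fun j => W1.fn (u j) x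

theorem H1.memLp_vec {d N : ℕ} {q : ℝ≥0∞} (h : SobolevEmbedding d q) (u : Fin N → H1 d) :
    MemLp (H1.vec u) q volume :=
  memLp_pi_iff.2 fun j => h.memLp (u j)

theorem MemLp.integrable_rpow {α E : Type*} [MeasurableSpace α] {μ : Measure α}
    [NormedAddCommGroup E] {p : ℝ} (hp : 0 < p) {f : α → E} (hf : MemLp f (ENNReal.ofReal p) μ) :
    Integrable (fun x => ‖f x‖ ^ p) μ := by
  have := hf.integrable_norm_rpow (by simpa using hp) ENNReal.ofReal_ne_top
  rwa [ENNReal.toReal_ofReal hp.le] at this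

theorem sobolevEmbedding_potential {d N : ℕ} (hd : 1 ≤ d) {g : (Fin N → ℂ) → ℝ} {p : ℝ}
    (hg : HomogeneousPotential d N g p) : SobolevEmbedding d (ENNReal.ofReal p) := by
  obtain ⟨q, hq, h⟩ := exists_sobolevEmbedding_gt hd hg.two_lt hg.lt_critExp
  exact h.interpolate hg.two_lt hq

theorem integrable_conj_mul_nonlin {d N : ℕ} (hd : 1 ≤ d) {g : (Fin N → ℂ) → ℝ} {p : ℝ}
    (hg : HomogeneousPotential d N g p) (u : Fin N → H1 d) (ψ : H1 d) (j : Fin N) :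
    Integrable (fun x => conj (W1.fn ψ x) * nonlin g p j (H1.vec u x)) := by
  have hS := sobolevEmbedding_potential hd hg
  have hp := hg.two_lt
  obtain ⟨C, hC, _, hb, _⟩ := potential_bounds hg
  have hI := MemLp.integrable_rpow (by linarith) ((H1.memLp_vec hS u).norm.add (hS.memLp ψ).norm)
  refine (hI.const_mul C).mono' ?_ (Eventually.of_forall fun x => ?_)
  · exact (Complex.continuous_conj.comp_aestronglyMeasurable (Lp.aestronglyMeasurable _)).mul
      ((continuous_nonlin hg j).comp_aestronglyMeasurable (H1.memLp_vec hS u).1)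
  · set a := ‖H1.vec u x‖
    set b := ‖W1.fn ψ x‖
    have h1 := (nonlin_le hg j (H1.vec u x)).trans (hb _)
    rw [norm_mul, RCLike.norm_conj, Pi.add_apply]
    have ha : 0 ≤ a := norm_nonneg _
    have hb' : 0 ≤ b := norm_nonneg _
    rw [Real.norm_of_nonneg (add_nonneg ha hb')]
    calc b * ‖nonlin g p j (H1.vec u x)‖ ≤ (a + b) * (C * (a + b) ^ (p - 1)) := by
          refine mul_le_mul (by linarith) (h1.trans ?_) (norm_nonneg _) (by positivity)
          gcongr
          · linarith
          · exact le_add_of_nonneg_right hb'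
      _ = C * (a + b) ^ p := by
          rcases (add_nonneg ha hb').eq_or_lt with h | h
          · rw [← h, Real.zero_rpow (by linarith), Real.zero_rpow (by linarith)]; simp
          · rw [Real.rpow_sub_one h.ne']; field_simp

/-! ### The first variation of the action -/

theorem hasDerivAt_integral_potential {d N : ℕ} (hd : 1 ≤ d) {g : (Fin N → ℂ) → ℝ} {p : ℝ}
    (hg : HomogeneousPotential d N g p) (u v : Fin N → H1 d) :
    HasDerivAt (fun t : ℝ => ∫ x, 1 / p * g (H1.vec (u + t • v) x))
      (∑ j, (∫ x, conj (W1.fn (v j) x) * nonlin g p j (H1.vec u x)).re) 0 := by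
  have hS := sobolevEmbedding_potential hd hg
  have hp := hg.two_lt
  obtain ⟨C, hC, hb0, hb, _⟩ := potential_bounds hg
  have hgd : Differentiable ℝ g := hg.contDiff.differentiable two_ne_zero
  have hu := H1.memLp_vec hS u
  have hv := H1.memLp_vec hS v
  have hvec : ∀ t : ℝ, H1.vec (u + t • v) =ᵐ[volume] fun x => H1.vec u x + t • H1.vec v x := by
    intro t
    have : ∀ᵐ x ∂(volume : Measure (RSpace d)), ∀ j, W1.fn ((u + t • v) j) x
        = W1.fn (u j) x + t • W1.fn (v j) x := by
      refine ae_all_iff.2 fun j => ?_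
      filter_upwards [Lp.coeFn_add (W1.fn (u j)) (t • W1.fn (v j)),
        Lp.coeFn_smul t (W1.fn (v j))] with x h1 h2
      change (W1.fn (u j) + t • W1.fn (v j)) x = _
      rw [h1, Pi.add_apply, h2, Pi.smul_apply]
    filter_upwards [this] with x hx
    exact funext hx
  have hI := MemLp.integrable_rpow (by linarith) (hu.norm.add hv.norm)
  have hmeas : ∀ t : ℝ, AEStronglyMeasurable (fun x => H1.vec u x + t • H1.vec v x) volume :=
    fun t => hu.1.add (hv.1.const_smul t)
  have main := hasDerivAt_integral_of_dominated_loc_of_deriv_le (𝕜 := ℝ)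
    (μ := (volume : Measure (RSpace d)))
    (F := fun t x => 1 / p * g (H1.vec u x + t • H1.vec v x))
    (F' := fun t x => 1 / p * fderiv ℝ g (H1.vec u x + t • H1.vec v x) (H1.vec v x))
    (x₀ := 0) (s := Metric.ball 0 1)
    (bound := fun x => C * ‖(fun y => ‖H1.vec u y‖) x + ‖H1.vec v x‖‖ ^ p)
    (Metric.ball_mem_nhds _ one_pos)
    (Eventually.of_forall fun t => ((hgd.continuous.comp_aestronglyMeasurable (hmeas t)).const_mul _))
    ?_ ?_ ?_ (hI.const_mul C) ?_
  · refine (main.2.congr_of_eventuallyEq (Eventually.of_forall fun t => ?_)).congr_deriv ?_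
    · refine integral_congr_ae ?_
      filter_upwards [hvec t] with x hx
      rw [hx]
    · simp only [zero_smul, add_zero, fderiv_potential_eq (show p ≠ 0 by linarith)]
      rw [integral_finsetSum]
      · refine Finset.sum_congr rfl fun j _ => ?_
        exact integral_re (integrable_conj_mul_nonlin hd hg u (v j) j)
      · exact fun j _ => (integrable_conj_mul_nonlin hd hg u (v j) j).re
  · simp only [zero_smul, add_zero]
    refine Integrable.const_mul ?_ _
    refine ((MemLp.integrable_rpow (by linarith) hu).const_mul C).mono'
      (hgd.continuous.comp_aestronglyMeasurable hu.1) (Eventually.of_forall fun x => ?_)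
    exact hb0 _
  · simp only [zero_smul, add_zero]
    have hc : Continuous (fun q : (Fin N → ℂ) × (Fin N → ℂ) => fderiv ℝ g q.1 q.2) :=
      ((hg.contDiff.continuous_fderiv two_ne_zero).comp continuous_fst).clm_apply continuous_snd
    exact (hc.comp_aestronglyMeasurable (hu.1.prodMk hv.1)).const_mul _
  · refine Eventually.of_forall fun x t ht => ?_
    set a := ‖H1.vec u x‖
    set b := ‖H1.vec v x‖
    have ha : 0 ≤ a := norm_nonneg _
    have hb' : 0 ≤ b := norm_nonneg _
    have ht' : |t| ≤ 1 := by
      rw [mem_ball_zero_iff] at ht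
      exact ht.le
    have hn : ‖H1.vec u x + t • H1.vec v x‖ ≤ a + b := by
      refine (norm_add_le _ _).trans ?_
      rw [norm_smul]
      gcongr
      exact mul_le_of_le_one_left hb' ht'
    rw [Real.norm_of_nonneg (add_nonneg ha hb'), norm_mul]
    have h1 : ‖1 / p‖ ≤ 1 := by
      rw [Real.norm_of_nonneg (by positivity), div_le_one (by linarith)]; linarith
    have h2 : ‖fderiv ℝ g (H1.vec u x + t • H1.vec v x) (H1.vec v x)‖ ≤
        (C * (a + b) ^ (p - 1)) * (a + b) := by
      refine (ContinuousLinearMap.le_opNorm _ _).trans ?_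
      refine mul_le_mul ((hb _).trans ?_) (by linarith) (norm_nonneg _) (by positivity)
      gcongr
      linarith
    calc _ ≤ 1 * ((C * (a + b) ^ (p - 1)) * (a + b)) := by gcongr
      _ = C * (a + b) ^ p := by
          rcases (add_nonneg ha hb').eq_or_lt with h | h
          · rw [← h, Real.zero_rpow (by linarith), Real.zero_rpow (by linarith)]; simp
          · rw [Real.rpow_sub_one h.ne']; field_simp
  · refine Eventually.of_forall fun x t _ => ?_
    have h1 : HasDerivAt (fun t : ℝ => H1.vec u x + t • H1.vec v x) (H1.vec v x) t := by
      simpa using ((hasDerivAt_id t).smul_const (H1.vec v x)).const_add (H1.vec u x)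
    exact ((hgd _).hasFDerivAt.comp_hasDerivAt t h1).const_mul _

theorem integral_norm_sq_L2 {d : ℕ} (f : LSpace d 2) : ∫ x, ‖f x‖ ^ 2 = ‖f‖ ^ 2 := by
  have h := inner_self_eq_norm_sq (𝕜 := ℂ) f
  rw [← h, L2.inner_def, ← integral_re (L2.integrable_inner f f)]
  congr 1 with x
  rw [inner_self_eq_norm_sq]

theorem integrable_norm_sq_L2 {d : ℕ} (f : LSpace d 2) : Integrable (fun x => ‖f x‖ ^ 2) := by
  have := (Lp.memLp f).integrable_norm_rpow (by norm_num) (by norm_num)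
  simpa using this

theorem hasDerivAt_norm_sq_L2 {d : ℕ} (a b : LSpace d 2) :
    HasDerivAt (fun t : ℝ => ‖a + t • b‖ ^ 2) (2 * (inner ℂ b a).re) 0 := by
  have h : ∀ t : ℝ, ‖a + t • b‖ ^ 2 = ‖a‖ ^ 2 + t * (2 * (inner ℂ b a).re) + t ^ 2 * ‖b‖ ^ 2 := by
    intro t
    rw [norm_add_sq (𝕜 := ℂ), norm_smul, ← algebraMap_smul ℂ t b, inner_smul_right, mul_pow,
      Real.norm_eq_abs, sq_abs]
    have hsymm : (inner ℂ a b).re = (inner ℂ b a).re := inner_re_symm (𝕜 := ℂ) a b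
    simp [hsymm]
    ring
  rw [funext h]
  have := (((hasDerivAt_id (0 : ℝ)).mul_const (2 * (inner ℂ b a).re)).const_add (‖a‖ ^ 2)).fun_add
    ((hasDerivAt_pow 2 (0 : ℝ)).mul_const (‖b‖ ^ 2))
  simpa using this

theorem action_eq {d N : ℕ} (g : (Fin N → ℂ) → ℝ) (p ω : ℝ) (u : Fin N → H1 d) :
    action g p ω u = (∑ j, (1 / 2 : ℝ) * ∑ k, ‖W1.grad (u j) k‖ ^ 2) +
      (∫ x, 1 / p * g (H1.vec u x)) + ω * ∑ j, (1 / 2 : ℝ) * ‖W1.fn (u j)‖ ^ 2 := by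
  unfold action energy mass
  congr 2
  · congr 1
    funext j
    rw [integral_const_mul, integral_finsetSum _ fun k _ => integrable_norm_sq_L2 _]
    simp only [integral_norm_sq_L2]
  · congr 1
    funext j
    rw [integral_const_mul, integral_norm_sq_L2]

theorem hasDerivAt_action {d N : ℕ} (hd : 1 ≤ d) {g : (Fin N → ℂ) → ℝ} {p : ℝ}
    (hg : HomogeneousPotential d N g p) (ω : ℝ) (u v : Fin N → H1 d) :
    HasDerivAt (fun t : ℝ => action g p ω (u + t • v))
      (∑ j, ((∑ k, (inner ℂ (W1.grad (v j) k) (W1.grad (u j) k)).re) +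
        (∫ x, conj (W1.fn (v j) x) * nonlin g p j (H1.vec u x)).re +
        ω * (inner ℂ (W1.fn (v j)) (W1.fn (u j))).re)) 0 := by
  simp only [action_eq]
  have h1 : HasDerivAt (fun t : ℝ => ∑ j, (1 / 2 : ℝ) * ∑ k, ‖W1.grad ((u + t • v) j) k‖ ^ 2)
      (∑ j, (1 / 2 : ℝ) * ∑ k, 2 * (inner ℂ (W1.grad (v j) k) (W1.grad (u j) k)).re) 0 :=
    HasDerivAt.fun_sum fun j _ => (HasDerivAt.fun_sum fun k _ =>
      hasDerivAt_norm_sq_L2 (W1.grad (u j) k) (W1.grad (v j) k)).const_mul _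
  have h2 : HasDerivAt (fun t : ℝ => ω * ∑ j, (1 / 2 : ℝ) * ‖W1.fn ((u + t • v) j)‖ ^ 2)
      (ω * ∑ j, (1 / 2 : ℝ) * (2 * (inner ℂ (W1.fn (v j)) (W1.fn (u j))).re)) 0 :=
    (HasDerivAt.fun_sum fun j _ =>
      (hasDerivAt_norm_sq_L2 (W1.fn (u j)) (W1.fn (v j))).const_mul _).const_mul _
  refine ((h1.add (hasDerivAt_integral_potential hd hg u v)).add h2).congr_deriv ?_
  rw [Finset.sum_add_distrib, Finset.sum_add_distrib, Finset.mul_sum]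
  simp only [Finset.mul_sum]
  congr 1
  · congr 1
    refine Finset.sum_congr rfl fun j _ => Finset.sum_congr rfl fun k _ => by ring
  · refine Finset.sum_congr rfl fun j _ => by ring

/-- The weak form of the elliptic system `-Δu_j + ωu_j = -F_j(u)`. -/
def IsWeakSolution {d N : ℕ} (g : (Fin N → ℂ) → ℝ) (p ω : ℝ) (u : Fin N → H1 d) : Prop :=
  ∀ (j : Fin N) (ψ : H1 d), (∑ k, inner ℂ (W1.grad ψ k) (W1.grad (u j) k)) +
    ω * inner ℂ (W1.fn ψ) (W1.fn (u j)) +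
    ∫ x, conj (W1.fn ψ x) * nonlin g p j (H1.vec u x) = 0

theorem isWeakSolution_of_mem {d N : ℕ} (hd : 1 ≤ d) {g : (Fin N → ℂ) → ℝ} {p : ℝ}
    (hg : HomogeneousPotential d N g p) {ω : ℝ} {u : Fin N → H1 d}
    (hu : u ∈ ellipticSolutions d g p ω) : IsWeakSolution g p ω u := by
  intro j ψ
  set B : H1 d → ℂ := fun ψ => (∑ k, inner ℂ (W1.grad ψ k) (W1.grad (u j) k)) +
    ω * inner ℂ (W1.fn ψ) (W1.fn (u j)) +
    ∫ x, conj (W1.fn ψ x) * nonlin g p j (H1.vec u x) with hB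
  have hre : ∀ ψ, (B ψ).re = 0 := by
    intro ψ
    have h1 := hasDerivAt_action hd hg ω u (Pi.single j ψ)
    have h2 : HasDerivAt (fun t : ℝ => action g p ω (u + t • (Pi.single j ψ : Fin N → H1 d))) 0 0 := by
      have hline : HasDerivAt (fun t : ℝ => u + t • (Pi.single j ψ : Fin N → H1 d))
          (Pi.single j ψ) 0 := by
        simpa using ((hasDerivAt_id (0 : ℝ)).smul_const (Pi.single j ψ : Fin N → H1 d)).const_add u
      have hF : HasFDerivAt (𝕜 := ℝ) (action g p ω) 0 (u + (0 : ℝ) • (Pi.single j ψ : Fin N → H1 d)) := by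
        rw [zero_smul, add_zero]; exact hu.2
      have := hF.comp_hasDerivAt (0 : ℝ) hline
      rwa [zero_apply] at this
    have h3 := h1.unique h2
    rw [Finset.sum_eq_single j] at h3
    · rw [Pi.single_eq_same] at h3
      simp only [hB, Complex.add_re, Complex.re_sum, Complex.re_ofReal_mul]
      linarith
    · intro i _ hij
      rw [Pi.single_eq_of_ne hij]
      have e1 : ∀ k, W1.grad (0 : H1 d) k = 0 := fun _ => rfl
      have e2 : W1.fn (0 : H1 d) = 0 := rfl
      have e3 : ∫ x, conj (W1.fn (0 : H1 d) x) * nonlin g p i (H1.vec u x) = 0 := by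
        rw [e2]
        refine integral_eq_zero_of_ae ?_
        filter_upwards [Lp.coeFn_zero ℂ 2 (volume : Measure (RSpace d))] with x hx
        rw [hx]; simp
      rw [e3]
      simp [e1, e2]
    · simp
  have hI : B (Complex.I • ψ) = -Complex.I * B ψ := by
    have e1 : ∀ k, W1.grad (Complex.I • ψ) k = Complex.I • W1.grad ψ k := fun _ => rfl
    have e2 : W1.fn (Complex.I • ψ) = Complex.I • W1.fn ψ := rfl
    have e3 : ∫ x, conj (W1.fn (Complex.I • ψ) x) * nonlin g p j (H1.vec u x) =
        -Complex.I * ∫ x, conj (W1.fn ψ x) * nonlin g p j (H1.vec u x) := by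
      rw [e2, ← integral_const_mul]
      refine integral_congr_ae ?_
      filter_upwards [Lp.coeFn_smul Complex.I (W1.fn ψ)] with x hx
      rw [hx, Pi.smul_apply, smul_eq_mul, map_mul, Complex.conj_I]
      ring
    simp only [hB]
    rw [e3]
    simp only [e1, e2, inner_smul_left, Complex.conj_I, ← Finset.mul_sum]
    ring
  have him : (B ψ).im = 0 := by
    have := hre (Complex.I • ψ)
    rw [hI] at this
    simpa using this
  exact Complex.ext (hre ψ) him

end

noncomputable section

open Filter Topology ComplexConjugate SchwartzMap
open scoped NNReal

/-! ### Multiplication by phases and translations -/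

theorem memLp_phase_mul {d : ℕ} {m : RSpace d → ℂ} (hc : Continuous m) (h1 : ∀ ξ, ‖m ξ‖ = 1)
    (f : LSpace d 2) : MemLp (fun ξ => m ξ * f ξ) 2 volume :=
  (Lp.memLp f).of_le (hc.aestronglyMeasurable.mul (Lp.aestronglyMeasurable f))
    (Eventually.of_forall fun ξ => by rw [norm_mul, h1, one_mul])

/-- Multiplication by a continuous function of modulus one, as an isometry of `L²`. -/
def phaseMul {d : ℕ} (m : RSpace d → ℂ) (hc : Continuous m) (h1 : ∀ ξ, ‖m ξ‖ = 1) :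
    LSpace d 2 →ₗᵢ[ℂ] LSpace d 2 where
  toFun f := (memLp_phase_mul hc h1 f).toLp _
  map_add' f g := by
    refine Lp.ext ?_
    filter_upwards [(memLp_phase_mul hc h1 (f + g)).coeFn_toLp,
      (memLp_phase_mul hc h1 f).coeFn_toLp, (memLp_phase_mul hc h1 g).coeFn_toLp,
      Lp.coeFn_add f g, Lp.coeFn_add ((memLp_phase_mul hc h1 f).toLp _)
        ((memLp_phase_mul hc h1 g).toLp _)] with ξ e1 e2 e3 e4 e5
    rw [e1, e5, Pi.add_apply, e2, e3, e4, Pi.add_apply, mul_add]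
  map_smul' c f := by
    refine Lp.ext ?_
    filter_upwards [(memLp_phase_mul hc h1 (c • f)).coeFn_toLp,
      (memLp_phase_mul hc h1 f).coeFn_toLp, Lp.coeFn_smul c f,
      Lp.coeFn_smul c ((memLp_phase_mul hc h1 f).toLp _)] with ξ e1 e2 e3 e4
    rw [e1, RingHom.id_apply, e4, Pi.smul_apply, e2, e3, Pi.smul_apply, smul_eq_mul, smul_eq_mul]
    ring
  norm_map' f := by
    change ‖(memLp_phase_mul hc h1 f).toLp _‖ = _
    rw [Lp.norm_toLp, Lp.norm_def]
    congr 1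
    exact eLpNorm_congr_norm_ae (Eventually.of_forall fun ξ => by rw [norm_mul, h1, one_mul])

theorem phaseMul_ae {d : ℕ} {m : RSpace d → ℂ} (hc : Continuous m) (h1 : ∀ ξ, ‖m ξ‖ = 1)
    (f : LSpace d 2) : phaseMul m hc h1 f =ᵐ[volume] fun ξ => m ξ * f ξ :=
  (memLp_phase_mul hc h1 f).coeFn_toLp

/-- The translation `f ↦ f(· + a)` on `L²`. -/
def translateL2 {d : ℕ} (a : RSpace d) : LSpace d 2 →+ LSpace d 2 :=
  Lp.compMeasurePreserving (· + a) (measurePreserving_add_right volume a)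

theorem translateL2_ae {d : ℕ} (a : RSpace d) (f : LSpace d 2) :
    translateL2 a f =ᵐ[volume] fun x => f (x + a) :=
  Lp.coeFn_compMeasurePreserving _ _

theorem translateL2_translate_neg {d : ℕ} (a : RSpace d) (f : LSpace d 2) :
    translateL2 a (translateL2 (-a) f) = f := by
  refine Lp.ext ?_
  have h := (measurePreserving_add_right (volume : Measure (RSpace d)) a).quasiMeasurePreserving.ae
    (translateL2_ae (-a) f)
  filter_upwards [translateL2_ae a (translateL2 (-a) f), h] with x h1 h2
  rw [h1, h2, add_neg_cancel_right]

theorem inner_translate {d : ℕ} (a : RSpace d) (f g : LSpace d 2) :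
    inner ℂ (translateL2 a f) (translateL2 a g) = inner ℂ f g :=
  (Lp.compMeasurePreservingₗᵢ (E := ℂ) (p := 2) ℂ (· + a)
    (measurePreserving_add_right volume a)).inner_map_map f g

/-- The character `ξ ↦ e^{2πi a·ξ}`. -/
def translationSymbol {d : ℕ} (a : RSpace d) (ξ : RSpace d) : ℂ :=
  Complex.exp ((2 * Real.pi * inner ℝ a ξ : ℝ) * Complex.I)

theorem continuous_translationSymbol {d : ℕ} (a : RSpace d) : Continuous (translationSymbol a) := by
  unfold translationSymbol
  fun_prop

theorem norm_translationSymbol {d : ℕ} (a ξ : RSpace d) : ‖translationSymbol a ξ‖ = 1 :=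
  Complex.norm_exp_ofReal_mul_I _

theorem fourier_translate {d : ℕ} (a : RSpace d) (f : LSpace d 2) :
    𝓕 (translateL2 a f) = phaseMul (translationSymbol a) (continuous_translationSymbol a)
      (norm_translationSymbol a) (𝓕 f) := by
  have hdense := SchwartzMap.denseRange_toLpCLM (E := RSpace d) (F := ℂ) (p := 2)
    (μ := (volume : Measure (RSpace d))) (by simp)
  have hF : Continuous (fun f : LSpace d 2 => (𝓕 f : LSpace d 2)) :=
    (Lp.fourierTransformₗᵢ (RSpace d) ℂ).continuous
  refine hdense.induction_on f (isClosed_eq ?_ ?_) fun u => ?_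
  · exact hF.comp (Lp.isometry_compMeasurePreserving _).continuous
  · exact (LinearIsometry.continuous _).comp hF
  · rw [SchwartzMap.toLpCLM_apply]
    have h1 : translateL2 a (u.toLp 2 volume) = (u.compSubConstCLM ℂ (-a)).toLp 2 volume := by
      refine Lp.ext ?_
      have h := (measurePreserving_add_right (volume : Measure (RSpace d)) a).quasiMeasurePreserving.ae
        (u.coeFn_toLp 2 volume)
      filter_upwards [translateL2_ae a (u.toLp 2 volume), h,
        (u.compSubConstCLM ℂ (-a)).coeFn_toLp 2 volume] with x e1 e2 e3
      rw [e1, e2, e3, compSubConstCLM_apply, sub_neg_eq_add]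
    rw [h1]
    refine Lp.ext ?_
    filter_upwards [fourier_toLp_ae (u.compSubConstCLM ℂ (-a)), fourier_toLp_ae u,
      phaseMul_ae (continuous_translationSymbol a) (norm_translationSymbol a)
        (𝓕 (u.toLp 2 volume))] with ξ e1 e2 e3
    rw [e1, e3, e2, SchwartzMap.fourier_coe, SchwartzMap.fourier_coe]
    have h2 : (u.compSubConstCLM ℂ (-a) : RSpace d → ℂ) = u ∘ fun v => v + a := by
      ext x; simp
    rw [h2]
    have h3 := congrFun (VectorFourier.fourierIntegral_comp_add_right Real.fourierChar
      (volume : Measure (RSpace d)) (innerₗ (RSpace d)) u a) ξ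
    refine h3.trans ?_
    rw [Circle.smul_def, Real.fourierChar_apply, smul_eq_mul]
    rfl

/-- Translation on `H¹`. -/
def H1.translate {d : ℕ} (a : RSpace d) (f : H1 d) : H1 d :=
  ⟨(translateL2 a (W1.fn f), fun k => translateL2 a (W1.grad f k)), fun k => by
    change IsWeakPartial k (translateL2 a (W1.fn f)) (translateL2 a (W1.grad f k))
    rw [isWeakPartial_iff_fourier, fourier_translate, fourier_translate]
    filter_upwards [phaseMul_ae (continuous_translationSymbol a) (norm_translationSymbol a)
      (𝓕 (W1.fn f)), phaseMul_ae (continuous_translationSymbol a) (norm_translationSymbol a)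
      (𝓕 (W1.grad f k)), H1.fourier_grad f k] with ξ h1 h2 h3
    rw [h1, h2, h3]
    ring⟩

theorem H1.fn_translate {d : ℕ} (a : RSpace d) (f : H1 d) :
    W1.fn (H1.translate a f) = translateL2 a (W1.fn f) := rfl

theorem H1.grad_translate {d : ℕ} (a : RSpace d) (f : H1 d) (k : Fin d) :
    W1.grad (H1.translate a f) k = translateL2 a (W1.grad f k) := rfl

theorem H1.vec_translate_ae {d N : ℕ} (a : RSpace d) (u : Fin N → H1 d) :
    H1.vec (fun j => H1.translate a (u j)) =ᵐ[volume] fun x => H1.vec u (x + a) := by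
  have : ∀ᵐ x ∂(volume : Measure (RSpace d)), ∀ j,
      W1.fn (H1.translate a (u j)) x = W1.fn (u j) (x + a) :=
    ae_all_iff.2 fun j => translateL2_ae a _
  filter_upwards [this] with x hx
  exact funext hx

theorem H1.translate_sub_translate {d : ℕ} (a : RSpace d) (f : H1 d) :
    H1.translate a (f - H1.translate (-a) f) = H1.translate a f - f := by
  have h : ∀ g : LSpace d 2, translateL2 a (g - translateL2 (-a) g)
      = translateL2 a g - g := fun g => by
    rw [map_sub, translateL2_translate_neg]
  refine Subtype.ext (Prod.ext (h _) (funext fun k => h _))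

theorem IsWeakSolution.translate {d N : ℕ} {g : (Fin N → ℂ) → ℝ} {p ω : ℝ} {u : Fin N → H1 d}
    (hu : IsWeakSolution g p ω u) (a : RSpace d) (j : Fin N) (ψ : H1 d) :
    (∑ k, inner ℂ (W1.grad (H1.translate a ψ) k) (W1.grad (H1.translate a (u j)) k)) +
      ω * inner ℂ (W1.fn (H1.translate a ψ)) (W1.fn (H1.translate a (u j))) +
      ∫ x, conj (W1.fn (H1.translate a ψ) x) *
        nonlin g p j (H1.vec (fun i => H1.translate a (u i)) x) = 0 := by
  simp only [H1.grad_translate, H1.fn_translate, inner_translate]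
  rw [← hu j ψ]
  congr 1
  rw [← integral_add_right_eq_self (fun x => conj (W1.fn ψ x) * nonlin g p j (H1.vec u x)) a]
  refine integral_congr_ae ?_
  filter_upwards [translateL2_ae a (W1.fn ψ), H1.vec_translate_ae a u] with x h1 h2
  rw [h1, h2]

/-! ### Difference quotients on the Fourier side -/

theorem fourier_translate_sub_ae {d : ℕ} (a : RSpace d) (f : LSpace d 2) :
    (𝓕 (translateL2 a f - f) : LSpace d 2) =ᵐ[volume]
      fun ξ => (translationSymbol a ξ - 1) * (𝓕 f : LSpace d 2) ξ := by
  have h : (𝓕 (translateL2 a f - f) : LSpace d 2) = 𝓕 (translateL2 a f) - 𝓕 f :=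
    (Lp.fourierTransformₗᵢ (RSpace d) ℂ).map_sub _ _
  rw [h, fourier_translate]
  filter_upwards [Lp.coeFn_sub (phaseMul (translationSymbol a) (continuous_translationSymbol a)
      (norm_translationSymbol a) (𝓕 f)) (𝓕 f), phaseMul_ae (continuous_translationSymbol a)
      (norm_translationSymbol a) (𝓕 f)] with ξ h1 h2
  rw [h1, Pi.sub_apply, h2]
  ring

theorem translationSymbol_single {d : ℕ} (l : Fin d) (t : ℝ) (ξ : RSpace d) :
    translationSymbol (EuclideanSpace.single l t) ξ = Complex.exp (t * partialSymbol l ξ) := by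
  have h : inner ℝ (EuclideanSpace.single l t) ξ = t * ξ l := by
    rw [EuclideanSpace.inner_single_left]; simp
  rw [translationSymbol, partialSymbol, h]
  congr 1
  push_cast
  ring

theorem H1.norm_translate_sub_le {d : ℕ} (f : H1 d) (l : Fin d) (t : ℝ) :
    ‖translateL2 (EuclideanSpace.single l t) (W1.fn f) - W1.fn f‖ ≤ |t| * ‖W1.grad f l‖ := by
  rw [← Lp.norm_fourier_eq, ← Lp.norm_fourier_eq (W1.grad f l)]
  refine Lp.norm_le_mul_norm_of_ae_le_mul ?_
  filter_upwards [fourier_translate_sub_ae (EuclideanSpace.single l t) (W1.fn f),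
    H1.fourier_grad f l] with ξ h1 h2
  rw [h1, h2, norm_mul, norm_mul, ← mul_assoc]
  gcongr
  rw [translationSymbol_single]
  have h3 : (t : ℂ) * partialSymbol l ξ = Complex.I * ((t * (2 * Real.pi * ξ l) : ℝ) : ℂ) := by
    rw [partialSymbol]; push_cast; ring
  rw [h3]
  refine (Real.norm_exp_I_mul_ofReal_sub_one_le).trans (le_of_eq ?_)
  rw [norm_partialSymbol, Real.norm_eq_abs, abs_mul, abs_mul, abs_of_pos (by positivity : 0 < 2 * Real.pi)]

theorem memLp_partialSymbol_mul_of_translate {d : ℕ} (f : LSpace d 2) (l : Fin d) {M : ℝ}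
    (h : ∀ t : ℝ, 0 < t → ‖translateL2 (EuclideanSpace.single l t) f - f‖ ≤ M * t) :
    MemLp (fun ξ => partialSymbol l ξ * (𝓕 f : LSpace d 2) ξ) 2 volume := by
  have hpos : ∀ n : ℕ, (0 : ℝ) < 1 / ((n : ℝ) + 1) := fun n => Nat.one_div_pos_of_nat
  set t : ℕ → ℝ := fun n => 1 / ((n : ℝ) + 1)
  set D : ℕ → LSpace d 2 := fun n =>
    ((t n)⁻¹ : ℂ) • 𝓕 (translateL2 (EuclideanSpace.single l (t n)) f - f) with hD
  have hDn : ∀ n, eLpNorm (D n) 2 volume ≤ ENNReal.ofReal M := fun n => by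
    rw [← Lp.enorm_def, ← ofReal_norm]
    refine ENNReal.ofReal_le_ofReal ?_
    rw [hD, norm_smul, Lp.norm_fourier_eq, norm_inv, Complex.norm_real,
      Real.norm_of_nonneg (hpos n).le, inv_mul_le_iff₀ (hpos n), mul_comm]
    exact h _ (hpos n)
  have hae : ∀ᵐ ξ ∂(volume : Measure (RSpace d)), ∀ n, D n ξ =
      ((t n)⁻¹ : ℂ) * ((Complex.exp (t n * partialSymbol l ξ) - 1) * (𝓕 f : LSpace d 2) ξ) := by
    refine ae_all_iff.2 fun n => ?_
    filter_upwards [Lp.coeFn_smul ((t n)⁻¹ : ℂ)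
      (𝓕 (translateL2 (EuclideanSpace.single l (t n)) f - f) : LSpace d 2),
      fourier_translate_sub_ae (EuclideanSpace.single l (t n)) f] with ξ h1 h2
    rw [hD, h1, Pi.smul_apply, h2, translationSymbol_single, smul_eq_mul]
  refine ⟨(continuous_partialSymbol l).aestronglyMeasurable.mul (Lp.aestronglyMeasurable _), ?_⟩
  refine lt_of_le_of_lt (Lp.eLpNorm_lim_le_liminf_eLpNorm (f := fun n => D n)
    (fun n => Lp.aestronglyMeasurable _) _ ?_)
    (lt_of_le_of_lt (liminf_le_of_frequently_le' (Frequently.of_forall hDn)) ENNReal.ofReal_lt_top)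
  filter_upwards [hae] with ξ hξ
  simp only [hξ, ← mul_assoc]
  refine Tendsto.mul_const _ ?_
  have h1 : HasDerivAt (fun s : ℝ => Complex.exp (s * partialSymbol l ξ)) (partialSymbol l ξ) 0 := by
    have h2 : HasDerivAt (fun s : ℝ => (s : ℂ) * partialSymbol l ξ) (partialSymbol l ξ) 0 := by
      simpa using (Complex.ofRealCLM.hasDerivAt (x := (0 : ℝ))).mul_const (partialSymbol l ξ)
    simpa using h2.cexp
  have h2 := h1.tendsto_slope_zero_right
  have h3 : Tendsto t atTop (𝓝[>] 0) :=
    tendsto_nhdsWithin_iff.2 ⟨tendsto_one_div_add_atTop_nhds_zero_nat, Eventually.of_forall hpos⟩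
  refine (h2.comp h3).congr fun n => ?_
  simp

/-- A function of `H¹` whose gradient has bounded difference quotients has gradient in `H¹`. -/
theorem exists_H1_of_translate {d : ℕ} (f : LSpace d 2) {M : ℝ}
    (h : ∀ (l : Fin d) (t : ℝ), 0 < t → ‖translateL2 (EuclideanSpace.single l t) f - f‖ ≤ M * t) :
    ∃ G : H1 d, W1.fn G = f := by
  have hm := fun l => memLp_partialSymbol_mul_of_translate f l (h l)
  refine ⟨⟨(f, fun l => 𝓕⁻ ((hm l).toLp _)), fun l => ?_⟩, rfl⟩
  rw [isWeakPartial_iff_fourier, FourierTransform.fourier_fourierInv_eq]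
  exact (hm l).coeFn_toLp

end

noncomputable section

open Filter Topology ComplexConjugate
open scoped NNReal

theorem absorb {a K X Y : ℝ} (ha : 0 < a) (hK : 0 ≤ K) (hX : 0 ≤ X) (hY : 0 ≤ Y)
    (h : X ^ 2 ≤ K * (Y ^ a * X ^ (1 - a)) ^ 2) : X ≤ K ^ (1 / (2 * a)) * Y := by
  rcases hX.eq_or_lt with rfl | hX
  · positivity
  have h1 : X ^ (2 * a) ≤ K * Y ^ (2 * a) := by
    have e1 : (Y ^ a * X ^ (1 - a)) ^ 2 = Y ^ (2 * a) * X ^ (2 - 2 * a) := by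
      rw [mul_pow, ← Real.rpow_natCast, ← Real.rpow_natCast, ← Real.rpow_mul hY,
        ← Real.rpow_mul hX.le]
      push_cast
      ring_nf
    have e2 : X ^ 2 = X ^ (2 * a) * X ^ (2 - 2 * a) := by
      rw [← Real.rpow_add hX, ← Real.rpow_natCast]
      push_cast
      ring_nf
    rw [e1, e2, ← mul_assoc] at h
    exact le_of_mul_le_mul_right h (by positivity)
  calc X = (X ^ (2 * a)) ^ (1 / (2 * a)) := by
        rw [← Real.rpow_mul hX.le, mul_one_div_cancel (by positivity), Real.rpow_one]
    _ ≤ (K * Y ^ (2 * a)) ^ (1 / (2 * a)) := by gcongr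
    _ = K ^ (1 / (2 * a)) * Y := by
        rw [Real.mul_rpow hK (by positivity), ← Real.rpow_mul hY,
          mul_one_div_cancel (by positivity), Real.rpow_one]

theorem eLpNorm_pi_le {α : Type*} [MeasurableSpace α] {μ : Measure α} {N : ℕ} {f : α → Fin N → ℂ}
    {q : ℝ≥0∞} (hq : 1 ≤ q) (hf : ∀ j, AEStronglyMeasurable (fun x => f x j) μ) :
    eLpNorm f q μ ≤ ∑ j, eLpNorm (fun x => f x j) q μ := by
  have h1 : eLpNorm f q μ ≤ eLpNorm (∑ j, fun x => ‖f x j‖) q μ := by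
    refine eLpNorm_mono fun x => ?_
    rw [Finset.sum_apply, Real.norm_of_nonneg (Finset.sum_nonneg fun _ _ => norm_nonneg _)]
    refine (pi_norm_le_iff_of_nonneg (Finset.sum_nonneg fun _ _ => norm_nonneg _)).2 fun j => ?_
    exact Finset.single_le_sum (f := fun j => ‖f x j‖) (fun _ _ => norm_nonneg _) (Finset.mem_univ j)
  refine h1.trans ((eLpNorm_sum_le (fun j _ => (hf j).norm) hq).trans ?_)
  simp only [eLpNorm_norm, le_refl]

theorem lintegral_rpow_mul_sq_le {α E E' : Type*} [MeasurableSpace α] {μ : Measure α}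
    [NormedAddCommGroup E] [NormedAddCommGroup E'] {p : ℝ} (hp : 2 < p) {u : α → E} {w : α → E'}
    (hu : AEStronglyMeasurable u μ) (hw : AEStronglyMeasurable w μ) :
    ∫⁻ x, ‖u x‖ₑ ^ (p - 2) * ‖w x‖ₑ ^ (2 : ℝ) ∂μ ≤
      eLpNorm u (ENNReal.ofReal p) μ ^ (p - 2) * eLpNorm w (ENNReal.ofReal p) μ ^ (2 : ℝ) := by
  have hp0 : 0 < p := by linarith
  have key := ENNReal.lintegral_mul_norm_pow_le (μ := μ) (f := fun x => ‖u x‖ₑ ^ p)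
    (g := fun x => ‖w x‖ₑ ^ p) (hu.enorm.pow_const _) (hw.enorm.pow_const _)
    (p := (p - 2) / p) (q := 2 / p) (div_nonneg (by linarith) hp0.le) (by positivity)
    (by field_simp; ring)
  simp only [← ENNReal.rpow_mul, mul_div_cancel₀ _ hp0.ne'] at key
  refine key.trans (le_of_eq ?_)
  rw [eLpNorm_eq_lintegral_rpow_enorm_toReal (by simpa using hp0) ENNReal.ofReal_ne_top,
    eLpNorm_eq_lintegral_rpow_enorm_toReal (by simpa using hp0) ENNReal.ofReal_ne_top,
    ENNReal.toReal_ofReal hp0.le, ← ENNReal.rpow_mul, ← ENNReal.rpow_mul]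
  congr 2 <;> field_simp

/-- The energy of an `H¹` function. -/
def H1.sqNorm {d : ℕ} (w : H1 d) : ℝ := (∑ k, ‖W1.grad w k‖ ^ 2) + ‖W1.fn w‖ ^ 2

theorem H1.sqNorm_nonneg {d : ℕ} (w : H1 d) : 0 ≤ w.sqNorm := by
  unfold H1.sqNorm; positivity

theorem H1.norm_grad_sq_le {d : ℕ} (w : H1 d) (k : Fin d) : ‖W1.grad w k‖ ^ 2 ≤ w.sqNorm := by
  have := Finset.single_le_sum (f := fun k => ‖W1.grad w k‖ ^ 2) (fun _ _ => sq_nonneg _)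
    (Finset.mem_univ k)
  unfold H1.sqNorm
  linarith [sq_nonneg ‖W1.fn w‖]

theorem H1.norm_sq_le {d : ℕ} (w : H1 d) : ‖w‖ ^ 2 ≤ w.sqNorm := by
  have h1 : ‖w‖ ≤ √w.sqNorm := by
    refine max_le ?_ ((pi_norm_le_iff_of_nonneg (Real.sqrt_nonneg _)).2 fun k => ?_)
    · refine Real.le_sqrt_of_sq_le ?_
      have : 0 ≤ ∑ k, ‖W1.grad w k‖ ^ 2 := by positivity
      change ‖W1.fn w‖ ^ 2 ≤ _
      unfold H1.sqNorm
      linarith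
    · exact Real.le_sqrt_of_sq_le (w.norm_grad_sq_le k)
  calc ‖w‖ ^ 2 ≤ √w.sqNorm ^ 2 := by gcongr
    _ = _ := Real.sq_sqrt w.sqNorm_nonneg

/-- The energy identity for the increment of a weak solution under a translation. -/
theorem IsWeakSolution.increment {d N : ℕ} (hd : 1 ≤ d) {g : (Fin N → ℂ) → ℝ} {p ω : ℝ}
    (hg : HomogeneousPotential d N g p) {u : Fin N → H1 d} (hu : IsWeakSolution g p ω u)
    (a : RSpace d) (j : Fin N) :
    (((∑ k, ‖W1.grad (H1.translate a (u j) - u j) k‖ ^ 2) +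
      ω * ‖W1.fn (H1.translate a (u j) - u j)‖ ^ 2 : ℝ) : ℂ) =
    - ∫ x, conj (W1.fn (H1.translate a (u j) - u j) x) *
      (nonlin g p j (H1.vec (fun i => H1.translate a (u i)) x) - nonlin g p j (H1.vec u x)) := by
  have h1 := hu.translate a j (u j - H1.translate (-a) (u j))
  rw [H1.translate_sub_translate] at h1
  set w := H1.translate a (u j) - u j
  have h2 := hu j w
  have h3 : ∫ x, conj (W1.fn w x) *
      (nonlin g p j (H1.vec (fun i => H1.translate a (u i)) x) - nonlin g p j (H1.vec u x))
      = (∫ x, conj (W1.fn w x) * nonlin g p j (H1.vec (fun i => H1.translate a (u i)) x)) -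
        ∫ x, conj (W1.fn w x) * nonlin g p j (H1.vec u x) := by
    rw [← integral_sub (integrable_conj_mul_nonlin hd hg _ _ _)
      (integrable_conj_mul_nonlin hd hg _ _ _)]
    simp only [mul_sub]
  have h4 : ∀ k, W1.grad w k = W1.grad (H1.translate a (u j)) k - W1.grad (u j) k := fun _ => rfl
  have h5 : W1.fn w = W1.fn (H1.translate a (u j)) - W1.fn (u j) := rfl
  have h6 : ∀ k, ((‖W1.grad w k‖ ^ 2 : ℝ) : ℂ) = inner ℂ (W1.grad w k) (W1.grad (H1.translate a (u j)) k)
      - inner ℂ (W1.grad w k) (W1.grad (u j) k) := fun k => by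
    rw [← inner_sub_right, ← h4, inner_self_eq_norm_sq_to_K]
    push_cast; rfl
  have h7 : ((‖W1.fn w‖ ^ 2 : ℝ) : ℂ) = inner ℂ (W1.fn w) (W1.fn (H1.translate a (u j)))
      - inner ℂ (W1.fn w) (W1.fn (u j)) := by
    rw [← inner_sub_right, ← h5, inner_self_eq_norm_sq_to_K]
    push_cast; rfl
  rw [h3, Complex.ofReal_add, Complex.ofReal_sum, Complex.ofReal_mul, h7]
  simp only [h6]
  rw [Finset.sum_sub_distrib]
  linear_combination h1 - h2

theorem enorm_integral_nonlin_sub_le {d N : ℕ} {g : (Fin N → ℂ) → ℝ} {p C : ℝ} (hp : 2 < p)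
    (hC : 0 ≤ C) (hb : ∀ z w, ‖fderiv ℝ g z - fderiv ℝ g w‖ ≤
      C * (‖z‖ ^ (p - 2) + ‖w‖ ^ (p - 2)) * ‖z - w‖) (j : Fin N) {φ : RSpace d → ℂ}
    {τ u w : RSpace d → Fin N → ℂ} (hτ : AEStronglyMeasurable τ volume)
    (hu : AEStronglyMeasurable u volume) (hw : AEStronglyMeasurable w volume)
    (hwae : ∀ᵐ x ∂(volume : Measure (RSpace d)), w x = τ x - u x) (hφ : ∀ x, ‖φ x‖ ≤ ‖w x‖) :
    ‖∫ x, conj (φ x) * (nonlin g p j (τ x) - nonlin g p j (u x))‖ₑ ≤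
      ENNReal.ofReal C * ((eLpNorm τ (ENNReal.ofReal p) volume ^ (p - 2) +
        eLpNorm u (ENNReal.ofReal p) volume ^ (p - 2)) *
        eLpNorm w (ENNReal.ofReal p) volume ^ (2 : ℝ)) := by
  refine (enorm_integral_le_lintegral_enorm _).trans ?_
  have hpt : ∀ᵐ x ∂(volume : Measure (RSpace d)),
      ‖conj (φ x) * (nonlin g p j (τ x) - nonlin g p j (u x))‖ₑ ≤
      ENNReal.ofReal C * (‖τ x‖ₑ ^ (p - 2) * ‖w x‖ₑ ^ (2 : ℝ) +
        ‖u x‖ₑ ^ (p - 2) * ‖w x‖ₑ ^ (2 : ℝ)) := by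
    filter_upwards [hwae] with x hx
    have h1 : ‖conj (φ x) * (nonlin g p j (τ x) - nonlin g p j (u x))‖ ≤
        C * (‖τ x‖ ^ (p - 2) * ‖w x‖ ^ (2 : ℝ) + ‖u x‖ ^ (p - 2) * ‖w x‖ ^ (2 : ℝ)) := by
      rw [norm_mul, RCLike.norm_conj]
      have h2 := (nonlin_sub_le (g := g) hp j (τ x) (u x)).trans (hb _ _)
      rw [← hx] at h2
      refine (mul_le_mul (hφ x) h2 (norm_nonneg _) (norm_nonneg _)).trans (le_of_eq ?_)
      rw [Real.rpow_two]
      ring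
    rw [← ofReal_norm, ← ofReal_norm, ← ofReal_norm, ← ofReal_norm,
      ENNReal.ofReal_rpow_of_nonneg (norm_nonneg (τ x)) (by linarith : 0 ≤ p - 2),
      ENNReal.ofReal_rpow_of_nonneg (norm_nonneg (u x)) (by linarith : 0 ≤ p - 2),
      ENNReal.ofReal_rpow_of_nonneg (norm_nonneg (w x)) zero_le_two,
      ← ENNReal.ofReal_mul (by positivity), ← ENNReal.ofReal_mul (by positivity),
      ← ENNReal.ofReal_add (by positivity) (by positivity), ← ENNReal.ofReal_mul hC]
    exact ENNReal.ofReal_le_ofReal h1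
  refine (lintegral_mono_ae hpt).trans ?_
  rw [lintegral_const_mul' _ _ ENNReal.ofReal_ne_top,
    lintegral_add_left' (f := fun x => ‖τ x‖ₑ ^ (p - 2) * ‖w x‖ₑ ^ (2 : ℝ))
      ((hτ.enorm.pow_const _).mul (hw.enorm.pow_const _)), add_mul]
  gcongr
  · exact lintegral_rpow_mul_sq_le hp hτ hw
  · exact lintegral_rpow_mul_sq_le hp hu hw

theorem H1.vec_sub_ae {d N : ℕ} (v u : Fin N → H1 d) :
    ∀ᵐ x ∂(volume : Measure (RSpace d)), H1.vec (fun i => v i - u i) x = H1.vec v x - H1.vec u x := by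
  have : ∀ᵐ x ∂(volume : Measure (RSpace d)), ∀ i,
      W1.fn (v i - u i) x = W1.fn (v i) x - W1.fn (u i) x :=
    ae_all_iff.2 fun i => Lp.coeFn_sub (W1.fn (v i)) (W1.fn (u i))
  filter_upwards [this] with x hx
  exact funext hx

theorem H1.eLpNorm_vec_translate {d N : ℕ} (a : RSpace d) (u : Fin N → H1 d) (q : ℝ≥0∞)
    (hu : AEStronglyMeasurable (H1.vec u) volume) :
    eLpNorm (H1.vec fun i => H1.translate a (u i)) q volume = eLpNorm (H1.vec u) q volume := by
  have h : eLpNorm (H1.vec u ∘ fun x => x + a) q volume = eLpNorm (H1.vec u) q volume :=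
    eLpNorm_comp_measurePreserving hu (measurePreserving_add_right volume a)
  rw [← h]
  exact eLpNorm_congr_ae (H1.vec_translate_ae a u)

theorem IsWeakSolution.sqNorm_increment_le {d N : ℕ} (hd : 1 ≤ d) {g : (Fin N → ℂ) → ℝ} {p ω : ℝ}
    (hg : HomogeneousPotential d N g p) (hω : 0 < ω) {u : Fin N → H1 d}
    (hu : IsWeakSolution g p ω u) : ∃ K : ℝ, 0 ≤ K ∧ ∀ (a : RSpace d) (j : Fin N),
      (H1.translate a (u j) - u j).sqNorm ≤
        K * (eLpNorm (H1.vec fun i => H1.translate a (u i) - u i)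
          (ENNReal.ofReal p) volume).toReal ^ 2 := by
  have hp := hg.two_lt
  have hS := sobolevEmbedding_potential hd hg
  obtain ⟨C, hC, _, _, hb⟩ := potential_bounds hg
  have hum := H1.memLp_vec hS u
  set P := eLpNorm (H1.vec u) (ENNReal.ofReal p) volume
  have hP : P ≠ ⊤ := hum.2.ne
  have hmin : 0 < min 1 ω := lt_min one_pos hω
  refine ⟨(min 1 ω)⁻¹ * (C * (2 * (P ^ (p - 2)).toReal)), by positivity, fun a j => ?_⟩
  have hwm := H1.memLp_vec hS (fun i => H1.translate a (u i) - u i)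
  have hint := enorm_integral_nonlin_sub_le hp hC hb j
    (H1.memLp_vec hS fun i => H1.translate a (u i)).1 hum.1 hwm.1
    (H1.vec_sub_ae (fun i => H1.translate a (u i)) u)
    (fun x => norm_le_pi_norm (H1.vec (fun i => H1.translate a (u i) - u i) x) j)
  rw [H1.eLpNorm_vec_translate a u _ hum.1, ← two_mul] at hint
  have hid := hu.increment hd hg a j
  set W := eLpNorm (H1.vec fun i => H1.translate a (u i) - u i) (ENNReal.ofReal p) volume
  have hW : W ≠ ⊤ := hwm.2.ne
  set w := H1.translate a (u j) - u j
  have hreal : (∑ k, ‖W1.grad w k‖ ^ 2) + ω * ‖W1.fn w‖ ^ 2 ≤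
      C * (2 * (P ^ (p - 2)).toReal * W.toReal ^ 2) := by
    have h1 : 0 ≤ (∑ k, ‖W1.grad w k‖ ^ 2) + ω * ‖W1.fn w‖ ^ 2 := by positivity
    have h2 : ‖(((∑ k, ‖W1.grad w k‖ ^ 2) + ω * ‖W1.fn w‖ ^ 2 : ℝ) : ℂ)‖ₑ ≤
        ENNReal.ofReal C * (2 * P ^ (p - 2) * W ^ (2 : ℝ)) := by
      rw [hid, enorm_neg]; exact hint
    have hfin : ENNReal.ofReal C * (2 * P ^ (p - 2) * W ^ (2 : ℝ)) ≠ ⊤ := by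
      refine ENNReal.mul_ne_top ENNReal.ofReal_ne_top (ENNReal.mul_ne_top (ENNReal.mul_ne_top
        (by simp) ?_) ?_)
      · exact ENNReal.rpow_ne_top_of_nonneg (by linarith) hP
      · exact ENNReal.rpow_ne_top_of_nonneg (by norm_num) hW
    have h3 := ENNReal.toReal_mono hfin h2
    rw [toReal_enorm, Complex.norm_real, Real.norm_of_nonneg h1] at h3
    simpa [ENNReal.toReal_mul, ENNReal.toReal_ofReal hC] using h3
  rw [mul_assoc, le_inv_mul_iff₀ hmin]
  calc min 1 ω * w.sqNorm ≤ (∑ k, ‖W1.grad w k‖ ^ 2) + ω * ‖W1.fn w‖ ^ 2 := by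
        unfold H1.sqNorm
        rw [mul_add]
        refine add_le_add (mul_le_of_le_one_left (by positivity) (min_le_left _ _)) ?_
        gcongr
        exact min_le_right _ _
    _ ≤ _ := by
        refine hreal.trans (le_of_eq ?_)
        ring

/-- Increments of the gradient are controlled by increments of the solution itself. -/
theorem IsWeakSolution.grad_increment_le {d N : ℕ} (hd : 1 ≤ d) {g : (Fin N → ℂ) → ℝ} {p ω : ℝ}
    (hg : HomogeneousPotential d N g p) (hω : 0 < ω) {u : Fin N → H1 d}
    (hu : IsWeakSolution g p ω u) : ∃ M : ℝ, 0 ≤ M ∧ ∀ (a : RSpace d) (j : Fin N) (k : Fin d),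
      ‖translateL2 a (W1.grad (u j) k) - W1.grad (u j) k‖ ≤
        M * ∑ i, ‖translateL2 a (W1.fn (u i)) - W1.fn (u i)‖ := by
  have hp := hg.two_lt
  obtain ⟨q, hq, C, hC⟩ := exists_sobolevEmbedding_gt hd hg.two_lt hg.lt_critExp
  obtain ⟨θ, hθ0, hθ1, hθ⟩ := eLpNorm_interpolate (E := Fin N → ℂ)
    (μ := (volume : Measure (RSpace d))) hp hq
  obtain ⟨K, hK, hb⟩ := hu.sqNorm_increment_le hd hg hω
  set L : ℝ := (C * N : ℝ) ^ (1 - θ) with hL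
  have hL0 : 0 ≤ L := by positivity
  refine ⟨(N * K * L ^ 2) ^ (1 / (2 * θ)), by positivity, fun a j k => ?_⟩
  set w : Fin N → H1 d := fun i => H1.translate a (u i) - u i with hw
  set Y := ∑ i, ‖W1.fn (w i)‖ with hY
  set X := √(∑ i, (w i).sqNorm) with hX
  have hsum0 : 0 ≤ ∑ i, (w i).sqNorm := Finset.sum_nonneg fun i _ => (w i).sqNorm_nonneg
  have hle : ∀ i, (w i).sqNorm ≤ X ^ 2 := fun i => by
    rw [hX, Real.sq_sqrt hsum0]
    exact Finset.single_le_sum (f := fun i => (w i).sqNorm) (fun i _ => (w i).sqNorm_nonneg)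
      (Finset.mem_univ i)
  have hX0 : 0 ≤ X := Real.sqrt_nonneg _
  have hY0 : 0 ≤ Y := by positivity
  have hcomp : ∀ i, AEStronglyMeasurable (fun x => H1.vec w x i) volume := fun i =>
    Lp.aestronglyMeasurable (W1.fn (w i))
  have h2 : eLpNorm (H1.vec w) 2 volume ≤ ENNReal.ofReal Y := by
    refine (eLpNorm_pi_le (by norm_num) hcomp).trans (le_of_eq ?_)
    rw [hY, ENNReal.ofReal_sum_of_nonneg fun _ _ => norm_nonneg _]
    refine Finset.sum_congr rfl fun i _ => ?_
    rw [ofReal_norm, Lp.enorm_def]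
    rfl
  have hqn : eLpNorm (H1.vec w) (ENNReal.ofReal q) volume ≤ ENNReal.ofReal (C * N * X) := by
    refine (eLpNorm_pi_le (by rw [ENNReal.one_le_ofReal]; linarith) hcomp).trans ?_
    have h3 : ∀ i, eLpNorm (fun x => H1.vec w x i) (ENNReal.ofReal q) volume ≤
        ENNReal.ofReal (C * X) := fun i => by
      refine (hC (w i)).trans ?_
      rw [ENNReal.ofReal_mul C.coe_nonneg, ENNReal.ofReal_coe_nnreal, ← ofReal_norm]
      gcongr
      exact (le_abs_self _).trans (abs_le_of_sq_le_sq ((w i).norm_sq_le.trans (hle i)) hX0)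
    refine (Finset.sum_le_sum fun i _ => h3 i).trans (le_of_eq ?_)
    rw [Finset.sum_const, Finset.card_univ, Fintype.card_fin, ← ENNReal.ofReal_nsmul]
    congr 1
    rw [nsmul_eq_mul]
    ring
  have hpn : (eLpNorm (H1.vec w) (ENNReal.ofReal p) volume).toReal ≤ L * (Y ^ θ * X ^ (1 - θ)) := by
    have hwm : AEStronglyMeasurable (H1.vec w) volume :=
      (H1.memLp_vec (sobolevEmbedding_potential hd hg) w).1
    refine ENNReal.toReal_le_of_le_ofReal (by positivity) ((hθ _ hwm).trans ?_)
    calc _ ≤ ENNReal.ofReal Y ^ θ * ENNReal.ofReal (C * N * X) ^ (1 - θ) := by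
          gcongr
      _ = ENNReal.ofReal (Y ^ θ) * ENNReal.ofReal ((C * N * X) ^ (1 - θ)) := by
          rw [ENNReal.ofReal_rpow_of_nonneg hY0 hθ0.le,
            ENNReal.ofReal_rpow_of_nonneg (by positivity) (by linarith)]
      _ = _ := by
          rw [← ENNReal.ofReal_mul (by positivity), Real.mul_rpow (by positivity) hX0, ← hL]
          congr 1
          ring
  have hmain : X ^ 2 ≤ (N * K * L ^ 2) * (Y ^ θ * X ^ (1 - θ)) ^ 2 := by
    calc X ^ 2 = ∑ i, (w i).sqNorm := Real.sq_sqrt hsum0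
      _ ≤ ∑ i : Fin N, K * (L * (Y ^ θ * X ^ (1 - θ))) ^ 2 := by
          refine Finset.sum_le_sum fun i _ => (hb a i).trans ?_
          gcongr
      _ = _ := by
          rw [Finset.sum_const, Finset.card_univ, Fintype.card_fin, nsmul_eq_mul]
          ring
  have hXY := absorb hθ0 (by positivity) hX0 hY0 hmain
  refine le_trans ?_ hXY
  have h4 : ‖W1.grad (w j) k‖ ^ 2 ≤ X ^ 2 := ((w j).norm_grad_sq_le k).trans (hle j)
  exact (le_abs_self _).trans (abs_le_of_sq_le_sq h4 hX0)

/-- Weak solutions of the elliptic system belong to `H²`. -/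
theorem IsWeakSolution.exists_grad_mem_H1 {d N : ℕ} (hd : 1 ≤ d) {g : (Fin N → ℂ) → ℝ} {p ω : ℝ}
    (hg : HomogeneousPotential d N g p) (hω : 0 < ω) {u : Fin N → H1 d}
    (hu : IsWeakSolution g p ω u) (j : Fin N) (k : Fin d) :
    ∃ G : H1 d, W1.fn G = W1.grad (u j) k := by
  obtain ⟨M, hM, h⟩ := hu.grad_increment_le hd hg hω
  refine exists_H1_of_translate _ (M := M * ∑ i, ‖u i‖) fun l t ht => (h _ j k).trans ?_
  rw [mul_assoc, Finset.sum_mul]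
  gcongr with i
  refine (H1.norm_translate_sub_le (u i) l t).trans ?_
  rw [abs_of_pos ht, mul_comm]
  gcongr
  exact W1.norm_grad_le _ _

end

noncomputable section

open Filter Topology ComplexConjugate SchwartzMap LineDeriv
open scoped NNReal

/-! ### The elliptic equation in `L²` -/

/-- A Schwartz function as an element of `H¹`. -/
def H1.ofSchwartz {d : ℕ} (ψ : 𝓢(RSpace d, ℂ)) : H1 d :=
  ⟨(ψ.toLp 2 volume, fun k => (∂_{(EuclideanSpace.single k 1 : RSpace d)} ψ).toLp 2 volume),
    fun k => by
      rw [isWeakPartial_iff_fourier]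
      filter_upwards [fourier_toLp_ae ψ,
        fourier_toLp_ae (∂_{(EuclideanSpace.single k 1 : RSpace d)} ψ)] with ξ h1 h2
      rw [h1, h2, SchwartzMap.fourier_lineDerivOp_eq, smul_apply,
        SchwartzMap.smulLeftCLM_apply_apply (by fun_prop), inner_single_eq, partialSymbol]
      simp [mul_assoc]⟩

theorem locallyIntegrable_nonlin {d N : ℕ} (hd : 1 ≤ d) {g : (Fin N → ℂ) → ℝ} {p : ℝ}
    (hg : HomogeneousPotential d N g p) (u : Fin N → H1 d) (j : Fin N) :
    LocallyIntegrable (fun x => nonlin g p j (H1.vec u x)) volume := by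
  have hS := sobolevEmbedding_potential hd hg
  have hp := hg.two_lt
  obtain ⟨C, hC, _, hb, _⟩ := potential_bounds hg
  have hum := H1.memLp_vec hS u
  have h1 : LocallyIntegrable (fun x => C * (1 + ‖H1.vec u x‖ ^ p)) volume := by
    have := (locallyIntegrable_const (μ := (volume : Measure (RSpace d))) (1 : ℝ)).add
      (MemLp.integrable_rpow (by linarith) hum).locallyIntegrable
    exact this.smul C
  refine h1.mono ((continuous_nonlin hg j).comp_aestronglyMeasurable hum.1)
    (Eventually.of_forall fun x => ?_)
  rw [Real.norm_of_nonneg (by positivity)]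
  refine (nonlin_le hg j _).trans ((hb _).trans ?_)
  gcongr
  rcases le_total ‖H1.vec u x‖ 1 with h | h
  · have h2 := Real.rpow_le_one (norm_nonneg _) h (by linarith : 0 ≤ p - 1)
    have h3 : 0 ≤ ‖H1.vec u x‖ ^ p := by positivity
    linarith
  · have h2 := Real.rpow_le_rpow_of_exponent_le h (by linarith : p - 1 ≤ p)
    linarith

theorem inner_toLp_real {d : ℕ} (ψ : 𝓢(RSpace d, ℂ)) {η : RSpace d → ℝ}
    (h : ∀ x, ψ x = (η x : ℂ)) (f : LSpace d 2) :
    inner ℂ (ψ.toLp 2 volume) f = ∫ x, η x • f x := by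
  rw [L2.inner_def]
  refine integral_congr_ae ?_
  filter_upwards [ψ.coeFn_toLp 2 volume] with x hx
  rw [hx, h, RCLike.inner_apply, Complex.conj_ofReal, Complex.real_smul, mul_comm]

/-- For a weak solution, `F_j(u)` belongs to `L²` and `F_j(u)^ = -(4π²|ξ|² + ω) û_j`. -/
theorem IsWeakSolution.exists_L2_nonlin {d N : ℕ} (hd : 1 ≤ d) {g : (Fin N → ℂ) → ℝ} {p ω : ℝ}
    (hg : HomogeneousPotential d N g p) (hω : 0 < ω) {u : Fin N → H1 d}
    (hu : IsWeakSolution g p ω u) (j : Fin N) : ∃ R : LSpace d 2,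
      R =ᵐ[volume] (fun x => nonlin g p j (H1.vec u x)) ∧
      (𝓕 R : LSpace d 2) =ᵐ[volume] fun ξ =>
        -((4 * Real.pi ^ 2 * ‖ξ‖ ^ 2 + ω : ℝ) : ℂ) * (𝓕 (W1.fn (u j)) : LSpace d 2) ξ := by
  choose G hG using fun k => hu.exists_grad_mem_H1 hd hg hω j k
  set R : LSpace d 2 := (∑ k, W1.grad (G k) k) - (ω : ℂ) • W1.fn (u j) with hR
  refine ⟨R, ?_, ?_⟩
  · refine ae_eq_of_integral_contDiff_smul_eq ((Lp.memLp R).locallyIntegrable (by norm_num))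
      (locallyIntegrable_nonlin hd hg u j) fun η hη hs => ?_
    have hs' : HasCompactSupport (Complex.ofRealCLM ∘ η) := hs.comp_left rfl
    have hη' : ContDiff ℝ (⊤ : ℕ∞) (Complex.ofRealCLM ∘ η) := by fun_prop
    set ψ : 𝓢(RSpace d, ℂ) := hs'.toSchwartzMap hη' with hψ
    have hψ1 : ∀ x, ψ x = (η x : ℂ) := fun x => rfl
    have hψ2 : ∀ k x, (∂_{(EuclideanSpace.single k 1 : RSpace d)} ψ) x
        = ((fderiv ℝ η x (EuclideanSpace.single k 1) : ℝ) : ℂ) := fun k x => by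
      have h1 : HasFDerivAt (Complex.ofRealCLM ∘ η) (Complex.ofRealCLM.comp (fderiv ℝ η x)) x :=
        Complex.ofRealCLM.hasFDerivAt.comp x (hη.differentiable (by simp) x).hasFDerivAt
      have h2 : (∂_{(EuclideanSpace.single k 1 : RSpace d)} ψ) x
          = fderiv ℝ (Complex.ofRealCLM ∘ η) x (EuclideanSpace.single k 1) := rfl
      rw [h2, h1.fderiv]
      rfl
    have hw := hu j (H1.ofSchwartz ψ)
    have e1 : ∀ k, inner ℂ (W1.grad (H1.ofSchwartz ψ) k) (W1.grad (u j) k)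
        = - inner ℂ (W1.fn (H1.ofSchwartz ψ)) (W1.grad (G k) k) := fun k => by
      have h1 := inner_toLp_real _ (hψ2 k) (W1.grad (u j) k)
      have h2 := inner_toLp_real _ hψ1 (W1.grad (G k) k)
      change inner ℂ ((∂_{(EuclideanSpace.single k 1 : RSpace d)} ψ).toLp 2 volume) _ = _
      rw [h1, ← hG k, W1.isWeakPartial (G k) k η hη hs, ← h2]
      rfl
    have e2 : ∫ x, conj (W1.fn (H1.ofSchwartz ψ) x) * nonlin g p j (H1.vec u x)
        = ∫ x, η x • nonlin g p j (H1.vec u x) := by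
      refine integral_congr_ae ?_
      filter_upwards [ψ.coeFn_toLp 2 volume] with x hx
      change conj (ψ.toLp 2 volume x) * _ = _
      rw [hx, hψ1, Complex.conj_ofReal, Complex.real_smul]
    have e3 : ∫ x, η x • R x = inner ℂ (W1.fn (H1.ofSchwartz ψ)) R := (inner_toLp_real ψ hψ1 R).symm
    rw [e3, hR, inner_sub_right, inner_sum, inner_smul_right]
    simp only [e1, e2, Finset.sum_neg_distrib] at hw
    linear_combination -hw
  · have hF : (𝓕 R : LSpace d 2) = (∑ k, 𝓕 (W1.grad (G k) k)) - (ω : ℂ) • 𝓕 (W1.fn (u j)) := by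
      have := (Lp.fourierTransformₗᵢ (RSpace d) ℂ).map_sub (∑ k, W1.grad (G k) k)
        ((ω : ℂ) • W1.fn (u j))
      rw [map_sum, map_smul] at this
      exact this
    have hall : ∀ᵐ ξ ∂(volume : Measure (RSpace d)), ∀ k, (𝓕 (W1.grad (G k) k) : LSpace d 2) ξ
        = partialSymbol k ξ * (partialSymbol k ξ * (𝓕 (W1.fn (u j)) : LSpace d 2) ξ) := by
      refine ae_all_iff.2 fun k => ?_
      have h1 := H1.fourier_grad (G k) k
      rw [hG k] at h1
      filter_upwards [h1, H1.fourier_grad (u j) k] with ξ h1 h2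
      rw [h1, h2]
    rw [hF]
    filter_upwards [hall, Lp.coeFn_sub (∑ k, (𝓕 (W1.grad (G k) k) : LSpace d 2))
      ((ω : ℂ) • (𝓕 (W1.fn (u j)) : LSpace d 2)),
      Lp.coeFn_smul (ω : ℂ) (𝓕 (W1.fn (u j)) : LSpace d 2),
      Lp.coeFn_finsetSum (Finset.univ) (fun k => (𝓕 (W1.grad (G k) k) : LSpace d 2))]
      with ξ h1 h2 h3 h4
    rw [h2, Pi.sub_apply, h3, h4, Finset.sum_apply, Pi.smul_apply, smul_eq_mul]
    simp only [h1, ← mul_assoc]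
    rw [← Finset.sum_mul, ← sub_mul]
    congr 1
    have h5 : ∀ k, partialSymbol k ξ * partialSymbol k ξ = -((4 * Real.pi ^ 2 * ξ k ^ 2 : ℝ) : ℂ) := by
      intro k
      rw [partialSymbol]
      push_cast
      linear_combination (4 * (Real.pi : ℂ) ^ 2 * (ξ k : ℂ) ^ 2) * Complex.I_sq
    simp only [h5, Finset.sum_neg_distrib]
    rw [EuclideanSpace.norm_sq_eq, ← Complex.ofReal_sum, ← Finset.mul_sum]
    simp only [Real.norm_eq_abs, sq_abs]
    push_cast
    ring

/-! ### The Duhamel formula -/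

theorem tendsto_eLpNorm_two_zero {α ι : Type*} [MeasurableSpace α] {μ : Measure α} {l : Filter ι}
    [l.IsCountablyGenerated] {f : ι → α → ℂ} {b : α → ℂ} (hb : MemLp b 2 μ)
    (hf : ∀ i, AEStronglyMeasurable (f i) μ) (hle : ∀ i, ∀ᵐ x ∂μ, ‖f i x‖ ≤ 2 * ‖b x‖)
    (hlim : ∀ᵐ x ∂μ, Tendsto (fun i => f i x) l (𝓝 0)) :
    Tendsto (fun i => eLpNorm (f i) 2 μ) l (𝓝 0) := by
  have hN : ∀ h : α → ℂ, eLpNorm h 2 μ = (∫⁻ x, ‖h x‖ₑ ^ (2 : ℝ) ∂μ) ^ (1 / 2 : ℝ) := fun h => by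
    rw [eLpNorm_eq_lintegral_rpow_enorm_toReal (by norm_num) (by norm_num)]
    norm_num
  have hb2 : ∫⁻ x, ‖(2 : ℂ) * b x‖ₑ ^ (2 : ℝ) ∂μ ≠ ⊤ := by
    have := lintegral_rpow_enorm_lt_top_of_eLpNorm_lt_top (by norm_num) (by norm_num)
      (hb.const_mul (2 : ℂ)).2
    simpa using this.ne
  have key : Tendsto (fun i => ∫⁻ x, ‖f i x‖ₑ ^ (2 : ℝ) ∂μ) l (𝓝 (∫⁻ _, 0 ∂μ)) := by
    refine tendsto_lintegral_filter_of_dominated_convergence' (fun x => ‖(2 : ℂ) * b x‖ₑ ^ (2 : ℝ))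
      (Eventually.of_forall fun i => (hf i).enorm.pow_const _) (Eventually.of_forall fun i => ?_)
      hb2 ?_
    · filter_upwards [hle i] with x hx
      gcongr
      rw [← ofReal_norm, ← ofReal_norm]
      refine ENNReal.ofReal_le_ofReal ?_
      rwa [norm_mul, Complex.norm_ofNat]
    · filter_upwards [hlim] with x hx
      have := (hx.enorm).ennrpow_const (2 : ℝ)
      simpa using this
  simp only [hN]
  have := key.ennrpow_const (1 / 2 : ℝ)
  simpa using this

end

noncomputable section

open Filter Topology ComplexConjugate
open scoped NNReal

/-- The unitary group `f ↦ exp(i s m) f` on `L²` generated by a continuous real symbol `m`. -/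
def phaseGroup {d : ℕ} (m : RSpace d → ℝ) (hm : Continuous m) (s : ℝ) :
    LSpace d 2 →ₗᵢ[ℂ] LSpace d 2 :=
  phaseMul (fun ξ => Complex.exp (Complex.I * (s * m ξ : ℝ))) (by fun_prop)
    (fun ξ => Complex.norm_exp_I_mul_ofReal _)

theorem phaseGroup_ae {d : ℕ} {m : RSpace d → ℝ} (hm : Continuous m) (s : ℝ) (f : LSpace d 2) :
    phaseGroup m hm s f =ᵐ[volume] fun ξ => Complex.exp (Complex.I * (s * m ξ : ℝ)) * f ξ :=
  phaseMul_ae _ _ f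

theorem continuous_phaseGroup {d : ℕ} {m : RSpace d → ℝ} (hm : Continuous m) (b : LSpace d 2) :
    Continuous fun s => phaseGroup m hm s b := by
  refine continuous_iff_continuousAt.2 fun s => (Lp.tendsto_Lp_iff_tendsto_eLpNorm' _ _).2 ?_
  have h := tendsto_eLpNorm_two_zero (l := 𝓝 s) (Lp.memLp b) (f := fun i ξ =>
    Complex.exp (Complex.I * (i * m ξ : ℝ)) * b ξ - Complex.exp (Complex.I * (s * m ξ : ℝ)) * b ξ)
    (fun i => by
      have := Lp.aestronglyMeasurable b
      exact ((Continuous.aestronglyMeasurable (by fun_prop)).mul this).sub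
        ((Continuous.aestronglyMeasurable (by fun_prop)).mul this))
    (fun i => .of_forall fun ξ => by
      refine (norm_sub_le _ _).trans (le_of_eq ?_)
      rw [norm_mul, norm_mul, Complex.norm_exp_I_mul_ofReal, Complex.norm_exp_I_mul_ofReal]
      ring)
    (.of_forall fun ξ => by
      have hc : Continuous fun i : ℝ => Complex.exp (Complex.I * (i * m ξ : ℝ)) * b ξ -
        Complex.exp (Complex.I * (s * m ξ : ℝ)) * b ξ := by fun_prop
      simpa using hc.tendsto s)
  refine h.congr fun i => eLpNorm_congr_ae ?_
  filter_upwards [phaseGroup_ae hm i b, phaseGroup_ae hm s b] with ξ h1 h2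
  rw [Pi.sub_apply, h1, h2]

theorem hasDerivAt_phaseGroup {d : ℕ} {m : RSpace d → ℝ} (hm : Continuous m) {a b : LSpace d 2}
    (hab : b =ᵐ[volume] fun ξ => (m ξ : ℂ) * a ξ) (s : ℝ) :
    HasDerivAt (fun s => phaseGroup m hm s a) (Complex.I • phaseGroup m hm s b) s := by
  rw [hasDerivAt_iff_tendsto_slope_zero]
  refine (Lp.tendsto_Lp_iff_tendsto_eLpNorm' _ _).2 ?_
  have hexp : ∀ ξ, HasDerivAt (fun i : ℝ => Complex.exp (Complex.I * (i * m ξ : ℝ)))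
      (Complex.exp (Complex.I * (s * m ξ : ℝ)) * (Complex.I * m ξ)) s := by
    intro ξ
    have h1 : HasDerivAt (fun i : ℝ => i * m ξ) (m ξ) s := by
      simpa using (hasDerivAt_id s).mul_const (m ξ)
    exact (h1.ofReal_comp.const_mul Complex.I).cexp
  have h := tendsto_eLpNorm_two_zero (l := 𝓝[≠] (0 : ℝ)) (Lp.memLp b) (f := fun i ξ =>
    i⁻¹ • (Complex.exp (Complex.I * ((s + i) * m ξ : ℝ)) * a ξ -
      Complex.exp (Complex.I * (s * m ξ : ℝ)) * a ξ) -
      Complex.I * (Complex.exp (Complex.I * (s * m ξ : ℝ)) * b ξ))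
    (fun i => by
      have ha := Lp.aestronglyMeasurable a
      have hb := Lp.aestronglyMeasurable b
      have hc : ∀ s : ℝ, AEStronglyMeasurable
          (fun ξ => Complex.exp (Complex.I * (s * m ξ : ℝ))) (volume : Measure (RSpace d)) :=
        fun s => Continuous.aestronglyMeasurable (by fun_prop)
      exact ((((hc (s + i)).mul ha).sub ((hc s).mul ha)).const_smul i⁻¹).sub
        (((hc s).mul hb).const_mul Complex.I))
    (fun i => by
      filter_upwards [hab] with ξ hξ
      have hsplit : Complex.exp (Complex.I * ((s + i) * m ξ : ℝ)) =
          Complex.exp (Complex.I * (s * m ξ : ℝ)) * Complex.exp (Complex.I * (i * m ξ : ℝ)) := by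
        rw [← Complex.exp_add]
        congr 1
        push_cast
        ring
      have hle : ‖i⁻¹ • (Complex.exp (Complex.I * ((s + i) * m ξ : ℝ)) * a ξ -
          Complex.exp (Complex.I * (s * m ξ : ℝ)) * a ξ)‖ ≤ ‖b ξ‖ := by
        rw [hsplit, mul_assoc, ← mul_sub, ← sub_one_mul, norm_smul, norm_mul, norm_mul,
          Complex.norm_exp_I_mul_ofReal, one_mul, hξ, norm_mul, ← mul_assoc]
        refine mul_le_mul_of_nonneg_right ?_ (norm_nonneg _)
        rw [norm_inv, Complex.norm_real]
        refine (mul_le_mul_of_nonneg_left (Real.norm_exp_I_mul_ofReal_sub_one_le (x := i * m ξ))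
          (by positivity)).trans ?_
        rw [norm_mul, ← mul_assoc]
        exact mul_le_of_le_one_left (norm_nonneg _) inv_mul_le_one
      refine (norm_sub_le _ _).trans ?_
      rw [norm_mul _ (_ * _), norm_mul _ (b ξ), Complex.norm_exp_I_mul_ofReal, Complex.norm_I]
      linarith)
    (by
      filter_upwards [hab] with ξ hξ
      have h1 := (hasDerivAt_iff_tendsto_slope_zero.1 ((hexp ξ).mul_const (a ξ))).sub_const
        (Complex.I * (Complex.exp (Complex.I * (s * m ξ : ℝ)) * b ξ))
      rw [hξ]
      rw [hξ] at h1
      convert h1 using 2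
      ring)
  refine h.congr fun i => eLpNorm_congr_ae ?_
  filter_upwards [phaseGroup_ae hm (s + i) a, phaseGroup_ae hm s a, phaseGroup_ae hm s b,
    Lp.coeFn_sub (i⁻¹ • (phaseGroup m hm (s + i) a - phaseGroup m hm s a))
      (Complex.I • phaseGroup m hm s b),
    Lp.coeFn_sub (phaseGroup m hm (s + i) a) (phaseGroup m hm s a),
    Lp.coeFn_smul i⁻¹ (phaseGroup m hm (s + i) a - phaseGroup m hm s a),
    Lp.coeFn_smul Complex.I (phaseGroup m hm s b)] with ξ h1 h2 h3 h4 h5 h6 h7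
  rw [Pi.sub_apply, h6, h7, Pi.smul_apply, Pi.smul_apply, h5, Pi.sub_apply, h1, h2, h3,
    smul_eq_mul]

theorem freeEvolution_eq {d : ℕ} (t : ℝ) (f : LSpace d 2) :
    freeEvolution t f = (Lp.fourierTransformₗᵢ (RSpace d) ℂ).symm
      (phaseMul (schrodingerSymbol t) (continuous_schrodingerSymbol t) (norm_schrodingerSymbol t)
        (Lp.fourierTransformₗᵢ (RSpace d) ℂ f)) := rfl

theorem freeEvolution_zero {d : ℕ} (f : LSpace d 2) : freeEvolution 0 f = f := by
  rw [freeEvolution_eq, LinearIsometryEquiv.symm_apply_eq]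
  refine Lp.ext ?_
  filter_upwards [phaseMul_ae (continuous_schrodingerSymbol (d := d) 0) (norm_schrodingerSymbol 0)
    (Lp.fourierTransformₗᵢ (RSpace d) ℂ f)] with ξ h
  rw [h]
  simp [schrodingerSymbol]

/-- `f ↦ e^{i t c Δ} 𝓕⁻ f` as a continuous linear map. -/
def freeEvolutionInv {d : ℕ} (t : ℝ) : LSpace d 2 →L[ℂ] LSpace d 2 :=
  (Lp.fourierTransformₗᵢ (RSpace d) ℂ).symm.toLinearIsometry.toContinuousLinearMap.comp
    (phaseMul (schrodingerSymbol t) (continuous_schrodingerSymbol t)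
      (norm_schrodingerSymbol t)).toContinuousLinearMap

theorem continuous_modulatedSymbol {d : ℕ} (c ω : ℝ) :
    Continuous fun ξ : RSpace d => c * (4 * Real.pi ^ 2 * ‖ξ‖ ^ 2 + ω) := by fun_prop

theorem freeEvolutionInv_phaseGroup {d : ℕ} (c ω t s : ℝ) (f : LSpace d 2) :
    freeEvolutionInv (t * c) (phaseGroup _ (continuous_modulatedSymbol c ω) s
      (Lp.fourierTransformₗᵢ (RSpace d) ℂ f)) =
      freeEvolution ((t - s) * c) (Complex.exp (Complex.I * (c * ω * s : ℝ)) • f) := by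
  rw [freeEvolution_eq]
  change (Lp.fourierTransformₗᵢ (RSpace d) ℂ).symm _ = _
  congr 1
  refine Lp.ext ?_
  rw [map_smul]
  set h := Lp.fourierTransformₗᵢ (RSpace d) ℂ f
  filter_upwards [phaseMul_ae (continuous_schrodingerSymbol (d := d) (t * c))
      (norm_schrodingerSymbol _) (phaseGroup _ (continuous_modulatedSymbol c ω) s h),
    phaseGroup_ae (continuous_modulatedSymbol c ω) s h,
    phaseMul_ae (continuous_schrodingerSymbol (d := d) ((t - s) * c)) (norm_schrodingerSymbol _)
      (Complex.exp (Complex.I * (c * ω * s : ℝ)) • h),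
    Lp.coeFn_smul (Complex.exp (Complex.I * (c * ω * s : ℝ))) h] with ξ h1 h2 h3 h4
  refine h1.trans ?_
  rw [h2, h3, h4, Pi.smul_apply, smul_eq_mul, schrodingerSymbol, schrodingerSymbol,
    ← mul_assoc (Complex.exp _), ← mul_assoc (Complex.exp _), ← Complex.exp_add,
    ← Complex.exp_add]
  congr 2
  push_cast
  ring

/-- The Duhamel formula for a time-periodic modulation of a profile `φ` with
`Δφ - ωφ = f`. -/
theorem duhamel_modulated {d : ℕ} (c ω : ℝ) {φ f : LSpace d 2}
    (hf : (𝓕 f : LSpace d 2) =ᵐ[volume] fun ξ =>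
      -((4 * Real.pi ^ 2 * ‖ξ‖ ^ 2 + ω : ℝ) : ℂ) * (𝓕 φ : LSpace d 2) ξ)
    (t : ℝ) :
    IntervalIntegrable (fun s => freeEvolution ((t - s) * c)
      ((c : ℂ) • Complex.exp (Complex.I * (c * ω * s : ℝ)) • f)) volume 0 t ∧
    Complex.exp (Complex.I * (c * ω * t : ℝ)) • φ = freeEvolution (t * c) φ -
      Complex.I • ∫ s in (0 : ℝ)..t, freeEvolution ((t - s) * c)
        ((c : ℂ) • Complex.exp (Complex.I * (c * ω * s : ℝ)) • f) := by
  have hm := continuous_modulatedSymbol (d := d) c ω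
  set T : LSpace d 2 →L[ℝ] LSpace d 2 := (freeEvolutionInv (t * c)).restrictScalars ℝ
  set FF := Lp.fourierTransformₗᵢ (RSpace d) ℂ
  have hG : (fun s => freeEvolution ((t - s) * c)
      ((c : ℂ) • Complex.exp (Complex.I * (c * ω * s : ℝ)) • f)) =
      fun s => T (phaseGroup _ hm s (FF ((c : ℂ) • f))) := by
    ext1 s
    rw [smul_comm]
    exact (freeEvolutionInv_phaseGroup c ω t s _).symm
  have hcont : Continuous fun s => T (phaseGroup _ hm s (FF ((c : ℂ) • f))) :=
    T.continuous.comp (continuous_phaseGroup hm _)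
  rw [hG]
  refine ⟨hcont.intervalIntegrable _ _, ?_⟩
  have hderiv : ∀ s, HasDerivAt (fun s => T (phaseGroup _ hm s (FF φ)))
      (-Complex.I • T (phaseGroup _ hm s (FF ((c : ℂ) • f)))) s := by
    intro s
    have h := hasDerivAt_phaseGroup hm (a := FF φ) (b := -FF ((c : ℂ) • f)) ?_ s
    · have h2 := T.hasFDerivAt.comp_hasDerivAt s h
      refine h2.congr_deriv ?_
      change freeEvolutionInv (t * c) _ = _
      rw [map_neg, smul_neg, map_neg, map_smul, neg_smul]
      rfl
    · rw [map_smul]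
      filter_upwards [hf, Lp.coeFn_neg ((c : ℂ) • FF f), Lp.coeFn_smul (c : ℂ) (FF f)]
        with ξ h1 h2 h3
      rw [h2, Pi.neg_apply, h3, Pi.smul_apply]
      change -((c : ℂ) • (𝓕 f : LSpace d 2) ξ) = _ * (𝓕 φ : LSpace d 2) ξ
      rw [h1, smul_eq_mul]
      push_cast
      ring
  have hint := intervalIntegral.integral_eq_sub_of_hasDerivAt (fun s _ => hderiv s)
    ((hcont.const_smul (-Complex.I)).intervalIntegrable 0 t)
  have h0 : T (phaseGroup _ hm 0 (FF φ)) = freeEvolution (t * c) φ := by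
    refine (freeEvolutionInv_phaseGroup c ω t 0 φ).trans ?_
    simp
  have ht : T (phaseGroup _ hm t (FF φ)) = Complex.exp (Complex.I * (c * ω * t : ℝ)) • φ := by
    refine (freeEvolutionInv_phaseGroup c ω t t φ).trans ?_
    rw [sub_self, zero_mul, freeEvolution_zero]
  rw [h0, ht, intervalIntegral.integral_smul, neg_smul] at hint
  rw [sub_eq_add_neg, hint]
  abel

/-! ### Gauge covariance -/

theorem nonlin_gauge {N : ℕ} {n : Fin N → ℕ} {g : (Fin N → ℂ) → ℝ} (hg : Differentiable ℝ g)
    (hgauge : GaugeInvariant n g) (p : ℝ) (j : Fin N) (z : Fin N → ℂ) (θ : ℝ) :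
    nonlin g p j (fun k => Complex.exp (Complex.I * (n k * θ : ℝ)) * z k) =
      Complex.exp (Complex.I * (n j * θ : ℝ)) * nonlin g p j z := by
  set e : Fin N → ℂ := fun k => Complex.exp (Complex.I * (n k * θ : ℝ)) with he
  set rot : (Fin N → ℂ) →L[ℝ] (Fin N → ℂ) := ContinuousLinearMap.pi fun k =>
    (e k) • (ContinuousLinearMap.proj (R := ℝ) (φ := fun _ : Fin N => ℂ) k)
  have hrot : ∀ w, rot w = fun k => e k * w k := fun w => by ext k; simp [rot]
  have hfd : ∀ w, fderiv ℝ g (fun k => e k * z k) (rot w) = fderiv ℝ g z w := by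
    have h1 : g ∘ rot = g := by
      ext w
      rw [Function.comp_apply, hrot]
      exact hgauge w θ
    have h2 : HasFDerivAt (g ∘ rot) ((fderiv ℝ g (rot z)).comp rot) z :=
      (hg (rot z)).hasFDerivAt.comp z rot.hasFDerivAt
    rw [h1] at h2
    intro w
    rw [h2.fderiv, hrot]
    rfl
  have hb : ∀ c : ℂ, fderiv ℝ g (fun k => e k * z k) (Pi.single j (e j * c)) =
      fderiv ℝ g z (Pi.single j c) := by
    intro c
    rw [← hfd, hrot]
    congr 1
    ext k
    by_cases hk : k = j
    · subst hk; simp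
    · simp [hk]
  set A := fderiv ℝ g (fun k => e k * z k)
  have hlin : ∀ c : ℂ, A (Pi.single j c) = c.re * A (Pi.single j 1) +
      c.im * A (Pi.single j Complex.I) := by
    intro c
    have : Pi.single j c = c.re • (Pi.single j 1 : Fin N → ℂ) +
        c.im • (Pi.single j Complex.I : Fin N → ℂ) := by
      rw [← Pi.single_smul, ← Pi.single_smul, ← Pi.single_add]
      congr 1
      simp
    rw [this, map_add, map_smul, map_smul, smul_eq_mul, smul_eq_mul]
  have hx := hb 1
  have hy := hb Complex.I
  rw [hlin] at hx hy
  have hns : (e j).re ^ 2 + (e j).im ^ 2 = 1 := by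
    have h : ‖e j‖ = 1 := Complex.norm_exp_I_mul_ofReal _
    have h2 := Complex.sq_norm (e j)
    rw [h, Complex.normSq_apply] at h2
    linarith
  simp only [nonlin, wirtingerBar]
  change _ = e j * _
  rw [← hx, ← hy]
  change _ * (_ * ((A (Pi.single j 1) : ℂ) + Complex.I * (A (Pi.single j Complex.I) : ℂ))) = _
  set X := A (Pi.single j 1)
  set Y := A (Pi.single j Complex.I)
  apply Complex.ext
  · simp
    linear_combination (-(2 / p * (2⁻¹ * X))) * hns
  · simp
    linear_combination (-(2 / p * (2⁻¹ * Y))) * hns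

/-! ### Higher integrability -/

theorem IsWeakPartial.congr {d : ℕ} {k : Fin d} {f f' h h' : RSpace d → ℂ}
    (H : IsWeakPartial k f h) (hf : f =ᵐ[volume] f') (hh : h =ᵐ[volume] h') :
    IsWeakPartial k f' h' := by
  intro η hη hs
  have h1 : ∫ x, fderiv ℝ η x (EuclideanSpace.single k 1) • f x =
      ∫ x, fderiv ℝ η x (EuclideanSpace.single k 1) • f' x :=
    integral_congr_ae (hf.mono fun x hx => by simp only [hx])
  have h2 : ∫ x, η x • h x = ∫ x, η x • h' x :=
    integral_congr_ae (hh.mono fun x hx => by simp only [hx])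
  rw [← h1, ← h2]
  exact H η hη hs

/-- An `H¹` function with derivatives in `H¹` belongs to `W^{1,r}` when `H¹` embeds in `L^r`. -/
theorem SobolevEmbedding.exists_W1 {d : ℕ} {r : ℝ≥0∞} [Fact (1 ≤ r)] (h : SobolevEmbedding d r)
    (u : H1 d) (hu : ∀ k, ∃ G : H1 d, W1.fn G = W1.grad u k) :
    ∃ v : W1 d r, W1.fn v =ᵐ[volume] W1.fn u := by
  choose G hG using hu
  refine ⟨⟨((h.memLp u).toLp _, fun k => (h.memLp (G k)).toLp _), fun k => ?_⟩,
    (h.memLp u).coeFn_toLp⟩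
  refine (W1.isWeakPartial u k).congr (h.memLp u).coeFn_toLp.symm ?_
  rw [← hG k]
  exact (h.memLp (G k)).coeFn_toLp.symm

theorem memLocLpW1_modulated {d : ℕ} {r : ℝ≥0∞} [Fact (1 ≤ r)] (q : ℝ≥0∞) (a : ℝ) {u : H1 d}
    {v : W1 d r} (hv : W1.fn v =ᵐ[volume] W1.fn u) (I : Set ℝ) :
    MemLocLpW1 I q r fun t => Complex.exp (Complex.I * (a * t : ℝ)) • u := by
  refine ⟨fun t => Complex.exp (Complex.I * (a * t : ℝ)) • v, .of_forall fun t => ?_,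
    fun K _ hK => ?_⟩
  · filter_upwards [Lp.coeFn_smul (Complex.exp (Complex.I * (a * t : ℝ))) (W1.fn v),
      Lp.coeFn_smul (Complex.exp (Complex.I * (a * t : ℝ))) (W1.fn u), hv] with x h1 h2 h3
    refine h1.trans (Eq.trans ?_ h2.symm)
    rw [Pi.smul_apply, Pi.smul_apply, h3]
  · have : IsFiniteMeasure (volume.restrict K) := ⟨by simpa using hK.measure_lt_top⟩
    refine MemLp.of_bound ?_ ‖v‖ (.of_forall fun t => ?_)
    · have hc : Continuous fun t : ℝ => Complex.exp (Complex.I * (a * t : ℝ)) := by fun_prop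
      have hs : Continuous fun t : ℝ => Complex.exp (Complex.I * (a * t : ℝ)) • v :=
        hc.smul continuous_const
      have : SecondCountableTopologyEither ℝ (W1 d r) :=
        secondCountableTopologyEither_of_left ℝ (W1 d r)
      exact hs.aestronglyMeasurable
    · rw [norm_smul, Complex.norm_exp_I_mul_ofReal, one_mul]

end

theorem theorem1p4 (d N : ℕ) (hd : 1 ≤ d) (hN : 2 ≤ N) (n : Fin N → ℕ) (hn : ∀ j, 0 < n j)
    (g : (Fin N → ℂ) → ℝ) (p : ℝ) (hg : HomogeneousPotential d N g p)
    (hgauge : GaugeInvariant n g) (ω : ℝ) (hω : 0 < ω)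
    (Φ : Fin N → H1 d) (hΦ : Φ ∈ ellipticSolutions d g p ω) :
    IsGlobalH1Solution n g hg.two_lt Φ (standingWave n ω Φ) := by
  have hw := isWeakSolution_of_mem hd hg hΦ
  choose R hR hRF using fun j => hw.exists_L2_nonlin hd hg hω j
  refine ⟨Set.ordConnected_univ, by simp, ?_, fun j => ?_,
    fun j s => Complex.exp (Complex.I * (n j * ω * s : ℝ)) • R j,
    fun j => .of_forall fun s => ?_, fun j t _ => ?_⟩
  · refine (continuous_pi fun j => ?_).continuousOn
    have hc : Continuous fun t : ℝ => Complex.exp (Complex.I * (n j * ω * t : ℝ)) := by fun_prop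
    exact hc.smul continuous_const
  · have : Fact (1 ≤ spaceExp d p) := ⟨one_le_spaceExp d hg.two_lt⟩
    obtain ⟨v, hv⟩ := (sobolevEmbedding_spaceExp hd hg.two_lt hg.lt_critExp).exists_W1 (Φ j)
      fun k => hw.exists_grad_mem_H1 hd hg hω j k
    exact memLocLpW1_modulated _ _ hv _
  · have hfn : ∀ᵐ x ∂volume, ∀ k, W1.fn (standingWave n ω Φ s k) x =
        Complex.exp (Complex.I * (n k * (ω * s) : ℝ)) * W1.fn (Φ k) x := by
      refine ae_all_iff.2 fun k => ?_
      filter_upwards [Lp.coeFn_smul (Complex.exp (Complex.I * (n k * ω * s : ℝ)))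
        (W1.fn (Φ k))] with x hx
      rw [← mul_assoc]
      exact hx
    filter_upwards [hfn, hR j, Lp.coeFn_smul (Complex.exp (Complex.I * (n j * ω * s : ℝ))) (R j)]
      with x h1 h2 h3
    simp only [h1]
    rw [h3, Pi.smul_apply, h2, nonlin_gauge (hg.contDiff.differentiable (by norm_num)) hgauge,
      smul_eq_mul, ← mul_assoc (n j : ℝ)]
    rfl
  · have h := duhamel_modulated (n j) ω (hRF j) t
    simp only [Complex.ofReal_natCast] at h
    exact h
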